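/- Let $G$ be a finite connected plane graph without loops and multiple edges, in which no vertex of degree one lies inside a bounded face. For each edge $e$ of $G$ shared by two different bounded faces, the planar dual $G^*$ (whose vertices are the bounded faces of $G$) has one edge $e^*$ crossing $e$. Let arbitrary weights (with values in a commutative monoid, written multiplicatively) be given on the edges of $G$ and on the edges of $G^*$. The dual refinement $H_G$ is the graph whose vertices are the vertices of $G$ (original vertices), the edges of $G$ (edge-vertices) and the bounded faces of $G$ (face-vertices); the edge-vertex of $e$ is joined to the two endpoints of $e$ and to the face-vertices of the bounded faces that contain $e$. An edge of $H_G$ that is half of an edge of $G$ or of $G^*$ gets the weight of that edge; all other edges of $H_G$ get weight $1$. The weight of a perfect matching is the product of the weights of its edges, and a bijection between sets of perfect matchings is weight-preserving if corresponding matchings have the same weight. Let $n\ge 0$ and let $v_1,\dots,v_{2n+1}$ and $v'_1,\dots,v'_{2n+1}$ be $4n+2$ distinct vertices of $G$ on the boundary of the infinite face such that (i) $v_1v_2\cdots v_{2n+1}$ is a path in $G$; (ii) $v'_1v'_2\cdots v'_{2n+1}$ is a path in $G$; (iii) $v_1,v_2,\dots,v_{2n+1},v'_{2n+1},v'_{2n},\dots,v'_1$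 are in cyclic order on the boundary of the infinite face (that is, one turn along its boundary walk, in one of the two directions and from a suitable starting point, meets them in this order); (iv) $v_2,v_4,\dots,v_{2n},v'_2,v'_4,\dots,v'_{2n}$ have degree $2$ and belong to distinct bounded faces $f_2,f_4,\dots,f_{2n},f'_2,f'_4,\dots,f'_{2n}$ of $G$, respectively. Let $\widehat H_G$ be obtained from $H_G$ by smashing in $v_2,v_4,\dots,v_{2n},v'_2,v'_4,\dots,v'_{2n}$, where smashing in a vertex $v$ means removing the original vertex $v$ and the two edge-vertices on the infinite face adjacent to $v$ (with all edges incident to them). (a) There is a weight-preserving bijection between the set of perfect matchings of $\widehat H_G\setminus\{v_1,f_2,v_3,f_4,\dots,f_{2n},v_{2n+1}\}$ and the set of perfect matchings of $\widehat H_G\setminus\{v'_1,f'_2,v'_3,f'_4,\dots,f'_{2n},v'_{2n+1}\}$. (b) More generally, let $P_1,\dots,P_{2n+1}$ be pairwise vertex-disjoint paths in $H_G$ such that $P_{2i-1}$ is a path in $G$ (that is, it contains no face-vertices) from $s_{P_{2i-1}}=v_{2i-1}$ to $e_{P_{2i-1}}=v'_{2i-1}$, for $1\le i\le n+1$, and $P_{2i}$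 is a path in $G^*$ (that is, it contains no original vertices) from $s_{P_{2i}}=f_{2i}$ to $e_{P_{2i}}=f'_{2i}$, for $1\le i\le n$. Then for every $I\subseteq\{1,\dots,2n+1\}$ there is a weight-preserving bijection between (1) the set of perfect matchings of $\widehat H_G\setminus\{v_1,f_2,v_3,f_4,\dots,f_{2n},v_{2n+1}\}$ which contain, for every $i\in I$, all the edges of the unique perfect matching of the path $P_i\setminus s_{P_i}$, and (2) the set of perfect matchings of $\widehat H_G\setminus\{v'_1,f'_2,v'_3,f'_4,\dots,f'_{2n},v'_{2n+1}\}$ which contain, for every $i\in I$, all the edges of the unique perfect matching of the path $P_i\setminus e_{P_i}$. -/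

import Mathlib

/-- A finite connected plane graph (with no loops and no multiple edges, and with at least one
edge), given up to isotopy by its rotation system: `rot` sends a dart (an edge with an orientation)
to the next dart around its first endpoint. The faces are the orbits of the face permutation
`d ↦ rot d.symm`, planarity is Euler's formula, and `outerDart` is a dart on the boundary walk of the
infinite face. -/
structure PlaneGraph (V : Type*) where
  /-- the underlying graph -/
  graph : SimpleGraph V
  /-- the underlying graph is connected -/
  connected : graph.Connected
  /-- the cyclic order of the darts around each vertex -/
  rot : Equiv.Perm graph.Dart
  /-- `rot` turns around the first endpoint -/
  rot_fst : ∀ d, (rot d).fst = d.fst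
  /-- the darts at one vertex form a single cycle of `rot` -/
  rot_sameCycle : ∀ d d', d.fst = d'.fst → rot.SameCycle d d'
  /-- a dart whose orbit is the infinite face -/
  outerDart : graph.Dart
  /-- Euler's formula `#V + #F = #E + 2`, the faces including the infinite one -/
  euler : Nat.card V +
      Nat.card (Quotient (Equiv.Perm.SameCycle.setoid
        ((Function.Involutive.toPerm _ (SimpleGraph.Dart.symm_involutive (G := graph))).trans rot)))
      = Nat.card graph.edgeSet + 2

namespace PlaneGraph

variable {V : Type*} (P : PlaneGraph V)

/-- The next dart along the boundary walk of a face: `d ↦ rot d.symm`. -/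
def faceNext : Equiv.Perm P.graph.Dart :=
  (Function.Involutive.toPerm _ (SimpleGraph.Dart.symm_involutive (G := P.graph))).trans P.rot

theorem faceNext_apply (d : P.graph.Dart) : P.faceNext d = P.rot d.symm := rfl

/-- The faces of the plane graph, including the infinite one. -/
def Face : Type _ := Quotient (Equiv.Perm.SameCycle.setoid P.faceNext)

/-- The face on whose boundary walk a dart lies. -/
def faceOf (d : P.graph.Dart) : P.Face := Quotient.mk _ d

/-- The infinite face. -/
def outer : P.Face := P.faceOf P.outerDart

/-- The bounded faces; these are the vertices of the planar dual. -/
def BoundedFace : Type _ := {f : P.Face // f ≠ P.outer}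

/-- The vertex `x` lies on the boundary of the face `f`. -/
def VertexOn (x : V) (f : P.Face) : Prop := ∃ d : P.graph.Dart, d.fst = x ∧ P.faceOf d = f

/-- The edge `e` lies on the boundary of the face `f`. -/
def EdgeOn (e : P.graph.edgeSet) (f : P.Face) : Prop :=
  ∃ d : P.graph.Dart, d.edge = e.1 ∧ P.faceOf d = f

/-- The edge `e` is shared by two different bounded faces, so that it is crossed by an edge of the
planar dual. -/
def IsDualEdge (e : P.graph.edgeSet) : Prop :=
  ∃ f g : P.BoundedFace, f ≠ g ∧ P.EdgeOn e f.1 ∧ P.EdgeOn e g.1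

/-- The edges of the planar dual: one for each edge of the graph that is shared by two different
bounded faces. -/
def DualEdge : Type _ := {e : P.graph.edgeSet // P.IsDualEdge e}

/-- The vertices `c 0, c 1, …` are distinct, lie on the boundary of the infinite face, and are met in
this cyclic order in one turn along its boundary walk, in one of the two directions. The turn visits
the first endpoints of `d, faceNext d, faceNext² d, …` for some dart `d` of the infinite face. -/
def InCyclicOrder {m : ℕ} (c : Fin m → V) : Prop :=
  Function.Injective c ∧
  ∃ d : P.graph.Dart, P.faceOf d = P.outer ∧
    ∃ p : Fin m → ℕ, (StrictMono p ∨ StrictAnti p) ∧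
      ∀ k, p k < Nat.card {d' : P.graph.Dart // P.faceOf d' = P.outer} ∧
        ((P.faceNext ^ p k) d).fst = c k

/-- The vertices of the dual refinement: original vertices, edge-vertices and face-vertices. -/
inductive RefVertex : Type _
  | orig (x : V) : RefVertex
  | edge (e : P.graph.edgeSet) : RefVertex
  | face (f : P.BoundedFace) : RefVertex

/-- Adjacency in the dual refinement: an edge-vertex is joined to the two endpoints of the edge and
to the bounded faces that contain the edge. -/
def refAdj : P.RefVertex → P.RefVertex → Prop
  | .orig x, .edge e => x ∈ e.1
  | .edge e, .orig x => x ∈ e.1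
  | .face f, .edge e => P.EdgeOn e f.1
  | .edge e, .face f => P.EdgeOn e f.1
  | _, _ => False

/-- The dual refinement `H_G` of the plane graph `G`. -/
def dualRefinement : SimpleGraph P.RefVertex where
  Adj := P.refAdj
  symm := ⟨by rintro (x | e | f) (y | e' | f') h <;> exact h⟩
  loopless := ⟨by rintro (x | e | f) h <;> exact h⟩

open Classical in
/-- The weight that a weight `w` on the edges of the graph and a weight `w'` on the edges of the
planar dual induce on a pair of adjacent vertices of the dual refinement: half-edges inherit the
weight of the edge of the graph or of its planar dual that contains them, all others have
weight `1`. -/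
noncomputable def pairWeight {R : Type*} [CommMonoid R]
    (w : P.graph.edgeSet → R) (w' : P.DualEdge → R) : P.RefVertex → P.RefVertex → R
  | .orig _, .edge e => w e
  | .edge e, .orig _ => w e
  | .face _, .edge e => if h : P.IsDualEdge e then w' ⟨e, h⟩ else 1
  | .edge e, .face _ => if h : P.IsDualEdge e then w' ⟨e, h⟩ else 1
  | _, _ => 1

theorem pairWeight_comm {R : Type*} [CommMonoid R]
    (w : P.graph.edgeSet → R) (w' : P.DualEdge → R) (a b : P.RefVertex) :
    P.pairWeight w w' a b = P.pairWeight w w' b a := by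
  cases a <;> cases b <;> rfl

/-- The induced weight on the edges of the dual refinement. -/
noncomputable def edgeWeight {R : Type*} [CommMonoid R]
    (w : P.graph.edgeSet → R) (w' : P.DualEdge → R) : Sym2 P.RefVertex → R :=
  Sym2.lift ⟨P.pairWeight w w', P.pairWeight_comm w w'⟩

/-- The weight of a set of edges of the dual refinement (given as a subgraph): the product of the
weights of its edges. -/
noncomputable def weight {R : Type*} [CommMonoid R]
    (w : P.graph.edgeSet → R) (w' : P.DualEdge → R) (M : P.dualRefinement.Subgraph) : R :=
  ∏ᶠ e ∈ M.edgeSet, P.edgeWeight w w' e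

/-- The vertices of the dual refinement removed by smashing in `x`: the vertex `x` itself and the
edge-vertices on the infinite face adjacent to it. -/
def smashedVerts (x : V) : Set P.RefVertex :=
  {a | a = .orig x ∨ ∃ e : P.graph.edgeSet, a = .edge e ∧ x ∈ e.1 ∧ P.EdgeOn e P.outer}

/-- The dual refinement with all the vertices of the set `S` smashed in. -/
def smashed (S : Set V) : P.dualRefinement.Subgraph :=
  (⊤ : P.dualRefinement.Subgraph).deleteVerts (⋃ x ∈ S, P.smashedVerts x)

end PlaneGraph

/-- `M` is a perfect matching of the subgraph `K` of `H`. -/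
def SimpleGraph.Subgraph.IsPerfectMatchingOf {W : Type*} {H : SimpleGraph W}
    (M K : H.Subgraph) : Prop :=
  M ≤ K ∧ M.IsMatching ∧ M.verts = K.verts

/-- `M` contains all the edges of the (unique) perfect matching of the path `p` with the vertex `a`
removed. -/
def SimpleGraph.Subgraph.ContainsPathMatching {W : Type*} {H : SimpleGraph W}
    (M : H.Subgraph) {s t : W} (p : H.Walk s t) (a : W) : Prop :=
  ∃ N : H.Subgraph, N.IsPerfectMatchingOf (p.toSubgraph.deleteVerts {a}) ∧ N ≤ M

namespace PlaneGraph

variable {V : Type*} (P : PlaneGraph V)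

/-- The position, in the `0`-based list `v₁, v₂, …, v₂ₙ₊₁`, of its `k`-th vertex of even index: the
`0`-based `k` is sent to the position `2k+1` of `v₂₍ₖ₊₁₎`. -/
def evenPos {n : ℕ} (k : Fin n) : Fin (2 * n + 1) := ⟨2 * k.1 + 1, by omega⟩

/-- The list `v₁, f₂, v₃, f₄, …, f₂ₙ, v₂ₙ₊₁` of vertices of the dual refinement. Here `v i` is
`vᵢ₊₁` and `f k` is `f₂₍ₖ₊₁₎`. -/
def terminal {n : ℕ} (v : Fin (2 * n + 1) → V) (f : Fin n → P.BoundedFace)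
    (i : Fin (2 * n + 1)) : P.RefVertex :=
  if h : i.1 % 2 = 0 then .orig (v i) else .face (f ⟨i.1 / 2, by omega⟩)

/-- The dual refinement with the vertices `v₂, v₄, …, v₂ₙ, v'₂, v'₄, …, v'₂ₙ` smashed in. -/
def smashedRefinement {n : ℕ} (v v' : Fin (2 * n + 1) → V) : P.dualRefinement.Subgraph :=
  P.smashed (Set.range (fun k : Fin n => v (evenPos k)) ∪
    Set.range (fun k : Fin n => v' (evenPos k)))

/-- The conditions on the boundary vertices `v₁, …, v₂ₙ₊₁` and `v'₁, …, v'₂ₙ₊₁`, where `f k` and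
`f' k` are the bounded faces that contain the vertices `v₂₍ₖ₊₁₎` and `v'₂₍ₖ₊₁₎`. -/
structure IsAdmissible {n : ℕ} (v v' : Fin (2 * n + 1) → V) (f f' : Fin n → P.BoundedFace) :
    Prop where
  /-- `v₁ v₂ ⋯ v₂ₙ₊₁` is a path -/
  path : Function.Injective v ∧ ∀ i : Fin (2 * n), P.graph.Adj (v i.castSucc) (v i.succ)
  /-- `v'₁ v'₂ ⋯ v'₂ₙ₊₁` is a path -/
  path' : Function.Injective v' ∧ ∀ i : Fin (2 * n), P.graph.Adj (v' i.castSucc) (v' i.succ)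
  /-- `v₁, …, v₂ₙ₊₁, v'₂ₙ₊₁, …, v'₁` are in cyclic order on the boundary of the infinite face -/
  cyclic : P.InCyclicOrder (Fin.append v (fun i => v' i.rev))
  /-- the vertices of even index have degree two -/
  degree_two : ∀ k : Fin n, (P.graph.neighborSet (v (evenPos k))).ncard = 2 ∧
    (P.graph.neighborSet (v' (evenPos k))).ncard = 2
  /-- the vertices of even index belong to the bounded faces `f k`, `f' k` -/
  on_face : ∀ k : Fin n, P.VertexOn (v (evenPos k)) (f k).1 ∧ P.VertexOn (v' (evenPos k)) (f' k).1
  /-- these `2n` bounded faces are distinct -/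
  faces_distinct : Function.Injective (Sum.elim f f')

/-- Pairwise disjoint paths `P₁, …, P₂ₙ₊₁` in the dual refinement from the vertices of the list
`v₁, f₂, v₃, …, f₂ₙ, v₂ₙ₊₁` to the corresponding ones of `v'₁, f'₂, v'₃, …, f'₂ₙ, v'₂ₙ₊₁`, those with
odd index along the graph (no face-vertices), those with even index along its planar dual (no
original vertices). -/
structure IsPathFamily {n : ℕ} (v v' : Fin (2 * n + 1) → V) (f f' : Fin n → P.BoundedFace)
    (p : ∀ i : Fin (2 * n + 1),
      P.dualRefinement.Walk (P.terminal v f i) (P.terminal v' f' i)) : Prop where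
  /-- each walk is a path -/
  isPath : ∀ i, (p i).IsPath
  /-- the paths `P₁, P₃, …` run along the graph -/
  inGraph : ∀ i, i.1 % 2 = 0 → ∀ g : P.BoundedFace, RefVertex.face g ∉ (p i).support
  /-- the paths `P₂, P₄, …` run along the planar dual -/
  inDual : ∀ i, i.1 % 2 = 1 → ∀ x : V, RefVertex.orig x ∉ (p i).support
  /-- the paths are non-intersecting -/
  disjoint : ∀ i j, i ≠ j → List.Disjoint (p i).support (p j).support

end PlaneGraph

/-!
A perfect matching `M` of the dual refinement with the vertices of `v₁, f₂, v₃, …, v₂ₙ₊₁` removed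
matches every remaining edge-vertex either to an endpoint of the edge or to a bounded face
containing it. Let `F` be the set of the edges of the first kind (`primalEdges M`). Both halves of
an edge of the graph have the same weight, and so have both halves of a dual edge, so the weight of
`M` depends on `F` only (`weight_eq`). The bijection sends `M` to the matching `M'` with the same
`F` that avoids `v'₁, f'₂, v'₃, …, v'₂ₙ₊₁`. It exists and is unique for the reason behind
Temperley's bijection: a spanning tree can be oriented towards any root in exactly one way.

In detail, let `D` be the set of the edges that are matched to a face. Adding to `F` the path
`v₁ v₂ ⋯ v₂ₙ₊₁` and one edge at each `v'₂ₖ` gives a set of edges marked by all vertices except `v₁`,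
and adding to `D` one edge at each `v₂ₖ`, which joins `f₂ₖ` to the infinite face in the dual, gives a
set of edges marked by all faces except the infinite one. Each of these two sets is a spanning tree,
of the graph and of the dual respectively (`SphereMap.IsMarking.reachable`): the component of the
root together with all its incident edges and faces is connected, so by Euler's formula
(`SphereMap.component_euler`), if it does not contain all vertices, there are fewer edges off it than
vertices and faces off it, whereas the marking injects the latter into the former. The complement of
the first tree is `D` with one edge at each `v'₂ₖ`, and the complement of the second one is `F` with
the path `v'₁ v'₂ ⋯ v'₂ₙ₊₁` and one edge at each `v₂ₖ`. Complements of spanning trees are spanning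
trees of the dual (`SphereMap.IsForest.reachable_dual`, `SphereMap.IsMarking.exists_dual`), and
orienting these complements towards the infinite face and towards `v'₁` gives `M'`
(`IsTrackPair.exists_orientation`). Uniqueness is `IsTrackPair.orientation_unique`.

If `M` contains the perfect matching of `Pᵢ` without its starting point, then every edge-vertex of
`Pᵢ` is matched in `M'` to a cell of the same dimension, hence to one of its two neighbours on `Pᵢ`.
As the end of `Pᵢ` is not available, going backwards from it shows that `M'` contains the perfect
matching of `Pᵢ` without its end (`containsPathMatching_of_primalEdges_eq`). So the bijection
restricts to the matchings that contain the matchings of prescribed paths. The cyclic order of the boundary vertices enters only through the facts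
that these vertices are distinct and lie on the infinite face.
-/

open Set

/-! ### Cell decompositions of the sphere -/

/-- A connected cell decomposition of the sphere with darts `D`, vertices `X`, edges `E` and faces
`Y`, given by its rotation system. The maps `vert`, `edge` and `face` identify the cells with the
orbits of the permutations of the darts, so that vertices and faces play symmetric roles. -/
structure SphereMap (D X E Y : Type*) where
  /-- reversal of darts -/
  rev : D → D
  rev_rev : ∀ d, rev (rev d) = d
  /-- the next dart around a vertex -/
  rotV : Equiv.Perm D
  /-- the next dart around a face -/
  rotF : Equiv.Perm D
  rotF_apply : ∀ d, rotF d = rotV (rev d)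
  /-- the vertex from which a dart starts -/
  vert : D → X
  /-- the edge of a dart -/
  edge : D → E
  /-- the face on one side of a dart -/
  face : D → Y
  vert_surj : Function.Surjective vert
  edge_surj : Function.Surjective edge
  face_surj : Function.Surjective face
  vert_eq : ∀ d d', vert d = vert d' ↔ rotV.SameCycle d d'
  edge_eq : ∀ d d', edge d = edge d' ↔ d' = d ∨ d' = rev d
  face_eq : ∀ d d', face d = face d' ↔ rotF.SameCycle d d'
  /-- connectedness, in a form that is invariant under duality -/
  conn : ∀ S : Set D, S.Nonempty → (∀ d ∈ S, rev d ∈ S) → (∀ d ∈ S, rotV d ∈ S) → S = univ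
  euler : Nat.card X + Nat.card Y = Nat.card E + 2

namespace SphereMap

variable {D X E Y : Type*} (m : SphereMap D X E Y)

theorem rotV_apply (d : D) : m.rotV d = m.rotF (m.rev d) := by
  rw [m.rotF_apply, m.rev_rev]

/-- The dual map: vertices and faces are exchanged. -/
def dual : SphereMap D Y E X where
  rev := m.rev
  rev_rev := m.rev_rev
  rotV := m.rotF
  rotF := m.rotV
  rotF_apply := m.rotV_apply
  vert := m.face
  edge := m.edge
  face := m.vert
  vert_surj := m.face_surj
  edge_surj := m.edge_surj
  face_surj := m.vert_surj
  vert_eq := m.face_eq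
  edge_eq := m.edge_eq
  face_eq := m.vert_eq
  conn S hS h1 h2 := m.conn S hS h1 fun d hd => by
    rw [m.rotV_apply]; exact h2 _ (h1 _ hd)
  euler := by rw [add_comm]; exact m.euler

theorem edge_rev (d : D) : m.edge (m.rev d) = m.edge d :=
  ((m.edge_eq d (m.rev d)).2 (Or.inr rfl)).symm

theorem vert_rotV (d : D) : m.vert (m.rotV d) = m.vert d :=
  ((m.vert_eq d _).2 ⟨1, by simp⟩).symm

theorem face_rotF (d : D) : m.face (m.rotF d) = m.face d := m.dual.vert_rotV d

theorem vert_rotF (d : D) : m.vert (m.rotF d) = m.vert (m.rev d) := by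
  rw [m.rotF_apply, m.vert_rotV]

theorem face_rotV (d : D) : m.face (m.rotV d) = m.face (m.rev d) := m.dual.vert_rotF d

/-- The graph on the vertices in which two different ends of an edge in `B` are adjacent. -/
def linkGraph (B : Set E) : SimpleGraph X where
  Adj x y := x ≠ y ∧ ∃ d, m.edge d ∈ B ∧ m.vert d = x ∧ m.vert (m.rev d) = y
  symm := ⟨by
    rintro x y ⟨hne, d, hd, rfl, rfl⟩
    exact ⟨hne.symm, m.rev d, by rwa [m.edge_rev], rfl, by rw [m.rev_rev]⟩⟩
  loopless := ⟨fun x h => h.1 rfl⟩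

theorem reachable_rev {B : Set E} {d : D} (hd : m.edge d ∈ B) :
    (m.linkGraph B).Reachable (m.vert d) (m.vert (m.rev d)) := by
  by_cases h : m.vert d = m.vert (m.rev d)
  · rw [← h]
  · exact SimpleGraph.Adj.reachable ⟨h, d, hd, rfl, rfl⟩

/-- The darts `p x`, for `x` in `Z`, make up a rooted forest: `p x` leads from `x` to its parent,
which has smaller height. Vertices outside `Z` carry junk values. -/
def IsForest (p : X → D) (ht : X → ℕ) (Z : Set X) : Prop :=
  ∀ x ∈ Z, m.vert (p x) = x ∧ ht (m.vert (m.rev (p x))) < ht x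

/-- A breadth-first search tree: each vertex of the component of `r` except `r` has a parent along an
edge in `B`. -/
theorem exists_forest (B : Set E) (r : X) :
    ∃ (p : X → D) (ht : X → ℕ),
      m.IsForest p ht {x | (m.linkGraph B).Reachable x r ∧ x ≠ r} ∧
      ∀ x, (m.linkGraph B).Reachable x r → x ≠ r → m.edge (p x) ∈ B := by
  have key : ∀ x, ∃ d : D, (m.linkGraph B).Reachable x r → x ≠ r →
      m.vert d = x ∧ m.edge d ∈ B ∧
        (m.linkGraph B).dist (m.vert (m.rev d)) r < (m.linkGraph B).dist x r := by
    intro x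
    by_cases h : (m.linkGraph B).Reachable x r ∧ x ≠ r
    · obtain ⟨W, hW⟩ := h.1.exists_walk_length_eq_dist
      revert hW
      cases W with
      | nil => exact fun _ => absurd rfl h.2
      | cons hadj W' =>
        intro hW
        rw [SimpleGraph.Walk.length_cons] at hW
        obtain ⟨-, d, hd, rfl, rfl⟩ := hadj
        refine ⟨d, fun _ _ => ⟨rfl, hd, ?_⟩⟩
        rw [← hW]
        exact Nat.lt_succ_of_le (SimpleGraph.dist_le W')
    · obtain ⟨d, -⟩ := m.vert_surj x
      exact ⟨d, fun h1 h2 => absurd ⟨h1, h2⟩ h⟩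
  choose p hp using key
  exact ⟨p, fun x => (m.linkGraph B).dist x r, fun x hx => ⟨(hp x hx.1 hx.2).1, (hp x hx.1 hx.2).2.2⟩,
    fun x h1 h2 => (hp x h1 h2).2.1⟩

variable {m}

theorem IsForest.injOn {p : X → D} {ht : X → ℕ} {Z : Set X} (h : m.IsForest p ht Z) :
    InjOn (fun x => m.edge (p x)) Z := by
  intro x hx y hy hxy
  rcases (m.edge_eq _ _).1 hxy with h1 | h1
  · rw [← (h x hx).1, ← (h y hy).1, h1]
  · have h2 := (h x hx).2
    have h3 := (h y hy).2
    rw [← h1, (h y hy).1] at h2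
    rw [h1, m.rev_rev, (h x hx).1] at h3
    omega

/-- A closed walk around a vertex cannot leave a set of faces and never come back. -/
theorem exists_crossing [Finite D] (S : Set Y) {d : D}
    (hd : ¬ (m.face d ∈ S ↔ m.face (m.rev d) ∈ S)) :
    ∃ d', d' ≠ d ∧ m.vert d' = m.vert d ∧ ¬ (m.face d' ∈ S ↔ m.face (m.rev d') ∈ S) := by
  by_contra! hcon
  -- otherwise the sides no longer change on the way from the successor of `d` back to `d`
  have key : ∀ k : ℕ, (∀ j < k, (m.rotV ^ j) (m.rotV d) ≠ d) →
      (m.face ((m.rotV ^ k) (m.rotV d)) ∈ S ↔ m.face (m.rev d) ∈ S) ∧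
        m.vert ((m.rotV ^ k) (m.rotV d)) = m.vert d := by
    intro k
    induction k with
    | zero => intro _; simp [m.face_rotV, m.vert_rotV]
    | succ k ih =>
      intro hk
      obtain ⟨h1, h2⟩ := ih fun j hj => hk j (by omega)
      have h3 := hcon _ (hk k (by omega)) h2
      rw [pow_succ', Equiv.Perm.mul_apply, m.face_rotV, m.vert_rotV]
      exact ⟨h3.symm.trans h1, h2⟩
  have hex : ∃ k : ℕ, (m.rotV ^ k) (m.rotV d) = d := by
    obtain ⟨k, -, hk⟩ := ((m.vert_eq (m.rotV d) d).1 (m.vert_rotV d)).exists_pow_eq'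
    exact ⟨k, hk⟩
  classical
  have h1 := key (Nat.find hex) fun j hj => Nat.find_min hex hj
  rw [Nat.find_spec hex] at h1
  exact hd h1.1

/-- The dual graph stays connected when the edges of a forest are removed. -/
theorem IsForest.reachable_dual [Finite D] {p : X → D} {ht : X → ℕ} {Z : Set X}
    (h : m.IsForest p ht Z) (y y' : Y) :
    (m.dual.linkGraph ((fun x => m.edge (p x)) '' Z)ᶜ).Reachable y y' := by
  set T := (fun x => m.edge (p x)) '' Z with hT
  set S : Set Y := {z | (m.dual.linkGraph Tᶜ).Reachable z y'} with hS
  have hmem : ∀ d, ¬ (m.face d ∈ S ↔ m.face (m.rev d) ∈ S) → m.edge d ∈ T := by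
    intro d hd
    by_contra hdT
    have := m.dual.reachable_rev (B := Tᶜ) (d := d) hdT
    exact hd ⟨fun h1 => this.symm.trans h1, fun h1 => this.trans h1⟩
  have : Finite X := Finite.of_surjective _ m.vert_surj
  by_cases hex : ∃ x ∈ Z, ¬ (m.face (p x) ∈ S ↔ m.face (m.rev (p x)) ∈ S)
  · exfalso
    obtain ⟨x, ⟨hxZ, hx⟩, hmax⟩ := (Set.toFinite
      {x | x ∈ Z ∧ ¬ (m.face (p x) ∈ S ↔ m.face (m.rev (p x)) ∈ S)}).exists_maximalFor ht _ hex
    -- the boundary of `S` consists of forest edges; at the upper end of a highest one, it could only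
    -- continue along the edge of a child, which is higher
    obtain ⟨d', hne, hv, hcr⟩ := exists_crossing S hx
    obtain ⟨z, hz, hzd⟩ := hmem d' hcr
    rcases (m.edge_eq _ _).1 hzd with h1 | h1
    · apply hne
      have : z = x := by rw [← (h z hz).1, ← (h x hxZ).1, ← h1, hv]
      rw [h1, this]
    · have h2 := (h z hz).2
      rw [← h1, hv, (h x hxZ).1] at h2
      have h3 : z ∈ {x | x ∈ Z ∧ ¬ (m.face (p x) ∈ S ↔ m.face (m.rev (p x)) ∈ S)} := by
        refine ⟨hz, ?_⟩
        rw [h1, m.rev_rev] at hcr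
        exact fun h4 => hcr h4.symm
      have := hmax h3 h2.le
      omega
  · push Not at hex
    have hcl : ∀ d, m.face d ∈ S ↔ m.face (m.rev d) ∈ S := by
      intro d
      by_contra hd
      obtain ⟨x, hx, hxd⟩ := hmem d hd
      rcases (m.edge_eq _ _).1 hxd with h1 | h1
      · rw [h1] at hd; exact hd (hex x hx)
      · rw [h1, m.rev_rev] at hd; exact hd (hex x hx).symm
    have huniv := m.conn {d | m.face d ∈ S} (by
        obtain ⟨d, hd⟩ := m.face_surj y'
        exact ⟨d, by change m.face d ∈ S; rw [hd]; exact SimpleGraph.Reachable.refl _⟩)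
      (fun d hd => (hcl d).1 hd)
      (fun d hd => by change m.face _ ∈ S; rw [m.face_rotV]; exact (hcl d).1 hd)
    obtain ⟨d, rfl⟩ := m.face_surj y
    exact huniv.symm.subset (mem_univ d)

theorem IsForest.mono {p : X → D} {ht : X → ℕ} {Z Z' : Set X} (h : m.IsForest p ht Z)
    (hZ : Z' ⊆ Z) : m.IsForest p ht Z' := fun x hx => h x (hZ hx)

variable (m)

theorem reachable_face_of_vert_eq [Finite D] {K : Set E} {d d' : D} (hv : m.vert d = m.vert d')
    (hK : ∀ e, m.vert e = m.vert d → m.edge e ∈ K) :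
    (m.dual.linkGraph K).Reachable (m.face d) (m.face d') := by
  obtain ⟨k, -, rfl⟩ := ((m.vert_eq d d').1 hv).exists_pow_eq'
  clear hv
  induction k with
  | zero => simp
  | succ k ih =>
    have hvk : m.vert ((m.rotV ^ k) d) = m.vert d := ((m.vert_eq _ _).2 ⟨k, by simp⟩).symm
    rw [pow_succ', Equiv.Perm.mul_apply, m.face_rotV]
    exact ih.trans (m.dual.reachable_rev (B := K) (hK _ hvk))

/-- Euler's inequality `#S - #KE + #KY ≤ 1` for a component `S` that is not everything, together with
the edges `KE` and the faces `KY` incident to it: the faces in `KY` except one have parent edges in a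
tree of the dual, and the vertices of `S` have parent edges off this tree. -/
theorem component_euler [Finite D] (B : Set E) (r : X)
    (hS : ∃ x, ¬ (m.linkGraph B).Reachable x r) :
    {x | (m.linkGraph B).Reachable x r}.ncard +
      {y | ∃ d, m.face d = y ∧ (m.linkGraph B).Reachable (m.vert d) r}.ncard ≤
      {e | ∃ d, m.edge d = e ∧ (m.linkGraph B).Reachable (m.vert d) r}.ncard + 1 := by
  have : Finite X := Finite.of_surjective _ m.vert_surj
  have : Finite E := Finite.of_surjective _ m.edge_surj
  have : Finite Y := Finite.of_surjective _ m.face_surj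
  set S : Set X := {x | (m.linkGraph B).Reachable x r} with hSdef
  set KE : Set E := {e | ∃ d, m.edge d = e ∧ (m.linkGraph B).Reachable (m.vert d) r} with hKE
  set KY : Set Y := {y | ∃ d, m.face d = y ∧ (m.linkGraph B).Reachable (m.vert d) r} with hKY
  obtain ⟨x₁, hx₁⟩ := hS
  obtain ⟨d₀, hd₀⟩ := m.vert_surj r
  have hwalk : ∀ x z, (m.linkGraph B).Walk x z → (m.linkGraph B).Reachable z r →
      ∀ d d', m.vert d = x → m.vert d' = z →
        (m.dual.linkGraph KE).Reachable (m.face d) (m.face d') := by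
    intro x z W
    induction W with
    | nil =>
      intro hr d d' hd hd'
      exact m.reachable_face_of_vert_eq (hd.trans hd'.symm)
        fun e he => ⟨e, rfl, by rw [he, hd]; exact hr⟩
    | cons hadj W ih =>
      intro hr d d' hd hd'
      obtain ⟨-, e, he, rfl, rfl⟩ := hadj
      have hr' := (m.reachable_rev he).trans (SimpleGraph.Reachable.trans ⟨W⟩ hr)
      have h1 := m.reachable_face_of_vert_eq (K := KE) hd
        fun e' he' => ⟨e', rfl, by rw [he', hd]; exact hr'⟩
      exact (h1.trans (m.dual.reachable_rev (B := KE) (d := e) ⟨e, rfl, hr'⟩)).trans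
        (ih hr _ _ rfl hd')
  have hreach : ∀ x, (m.linkGraph B).Reachable x r → ∀ d, m.vert d = x →
      (m.dual.linkGraph KE).Reachable (m.face d) (m.face d₀) := by
    rintro x ⟨W⟩ d hd
    exact hwalk x r W (SimpleGraph.Reachable.refl _) d d₀ hd hd₀
  obtain ⟨p, ht, hp, hpK⟩ := m.dual.exists_forest KE (m.face d₀)
  have hp' : m.dual.IsForest p ht (KY \ {m.face d₀}) := hp.mono (by
    rintro y ⟨⟨d, rfl, hd⟩, hne⟩
    exact ⟨hreach _ hd d rfl, hne⟩)
  have hinjp := hp'.injOn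
  set T := (fun y => m.dual.edge (p y)) '' (KY \ {m.face d₀}) with hT
  obtain ⟨q, ht', hq, hqT⟩ := m.exists_forest Tᶜ x₁
  have hall : ∀ x, (m.linkGraph Tᶜ).Reachable x x₁ := fun x => hp'.reachable_dual x x₁
  have hSx : ∀ x ∈ S, x ≠ x₁ := by
    rintro x hx rfl
    exact hx₁ hx
  have hq' : m.IsForest q ht' S := hq.mono fun x hx => ⟨hall x, hSx x hx⟩
  have hTK : T ⊆ KE := by
    rintro _ ⟨y, ⟨⟨d, rfl, hd⟩, hne⟩, rfl⟩
    exact hpK _ (hreach _ hd d rfl) hne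
  have hQK : (fun x => m.edge (q x)) '' S ⊆ KE := by
    rintro _ ⟨x, hx, rfl⟩
    exact ⟨q x, rfl, by rw [(hq' x hx).1]; exact hx⟩
  have hdisj : Disjoint ((fun x => m.edge (q x)) '' S) T := by
    rw [Set.disjoint_left]
    rintro _ ⟨x, hx, rfl⟩
    exact hqT x (hall x) (hSx x hx)
  have h1 := Set.ncard_le_ncard (union_subset hQK hTK)
  rw [Set.ncard_union_eq hdisj, hT, hinjp.ncard_image,
    hq'.injOn.ncard_image] at h1
  have h2 := Set.le_ncard_sdiff {m.face d₀} KY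
  rw [Set.ncard_singleton] at h2
  omega

section Marking

variable [Finite D] {μ : X → E} {ν : Y → E} {N : Set Y} {r : X}

/-- Each vertex except the root `r` marks an incident edge by `μ`, each face outside `N` marks an
incident edge by `ν`, and no edge is marked twice. The faces in `N` must touch the component of the
root along the edges marked by vertices. -/
structure IsMarking (r : X) (N : Set Y) (μ : X → E) (ν : Y → E) : Prop where
  vert_mem : ∀ x ≠ r, ∃ d, m.vert d = x ∧ m.edge d = μ x
  face_mem : ∀ y ∉ N, ∃ d, m.face d = y ∧ m.edge d = ν y
  injOn_vert : InjOn μ {r}ᶜ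
  injOn_face : InjOn ν Nᶜ
  disjoint : ∀ x ≠ r, ∀ y ∉ N, μ x ≠ ν y
  exempt : ∀ y ∈ N, ∃ d, m.face d = y ∧ (m.linkGraph (μ '' {r}ᶜ)).Reachable (m.vert d) r

variable {m}

/-- The edges marked by the vertices connect all vertices: the cells not incident to the component
of the root would mark too many edges. -/
theorem IsMarking.reachable (h : m.IsMarking r N μ ν) (x : X) :
    (m.linkGraph (μ '' {r}ᶜ)).Reachable x r := by
  by_contra hx
  have : Finite X := Finite.of_surjective _ m.vert_surj
  have : Finite E := Finite.of_surjective _ m.edge_surj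
  have : Finite Y := Finite.of_surjective _ m.face_surj
  have h0 := m.component_euler (μ '' {r}ᶜ) r ⟨x, hx⟩
  set B := μ '' {r}ᶜ with hB
  set S : Set X := {x | (m.linkGraph B).Reachable x r} with hSdef
  set KE : Set E := {e | ∃ d, m.edge d = e ∧ (m.linkGraph B).Reachable (m.vert d) r} with hKE
  set KY : Set Y := {y | ∃ d, m.face d = y ∧ (m.linkGraph B).Reachable (m.vert d) r} with hKY
  have hSr : Sᶜ ⊆ {r}ᶜ := by
    rintro z hz rfl
    exact hz (SimpleGraph.Reachable.refl _)
  have hYN : KYᶜ ⊆ Nᶜ := fun y hy hyN => hy (h.exempt y hyN)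
  have hμ : μ '' Sᶜ ⊆ KEᶜ := by
    rintro _ ⟨z, hz, rfl⟩ ⟨d, hd, hdr⟩
    obtain ⟨d', rfl, hd'⟩ := h.vert_mem z (hSr hz)
    have hB' : m.edge d' ∈ B := by rw [hd']; exact ⟨_, hSr hz, rfl⟩
    rcases (m.edge_eq d' d).1 (hd'.trans hd.symm) with h1 | h1
    · rw [h1] at hdr; exact hz hdr
    · rw [h1] at hdr; exact hz ((m.reachable_rev hB').trans hdr)
  have hν : ν '' KYᶜ ⊆ KEᶜ := by
    rintro _ ⟨y, hy, rfl⟩ ⟨d, hd, hdr⟩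
    obtain ⟨d', rfl, hd'⟩ := h.face_mem y (hYN hy)
    rcases (m.edge_eq d' d).1 (hd'.trans hd.symm) with h1 | h1
    · rw [h1] at hdr; exact hy ⟨d', rfl, hdr⟩
    · rw [h1, ← m.vert_rotF] at hdr
      exact hy ⟨m.rotF d', m.face_rotF d', hdr⟩
  have hdisj : Disjoint (μ '' Sᶜ) (ν '' KYᶜ) := by
    rw [Set.disjoint_left]
    rintro _ ⟨z, hz, rfl⟩ ⟨y, hy, hzy⟩
    exact h.disjoint z (hSr hz) y (hYN hy) hzy.symm
  have h1 := Set.ncard_le_ncard (union_subset hμ hν)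
  rw [Set.ncard_union_eq hdisj, (h.injOn_vert.mono hSr).ncard_image,
    (h.injOn_face.mono hYN).ncard_image] at h1
  have h2 := Set.ncard_add_ncard_compl S
  have h3 := Set.ncard_add_ncard_compl KE
  have h4 := Set.ncard_add_ncard_compl KY
  have h5 := m.euler
  omega

/-- The edges marked by the vertices are those of a spanning tree with root `r`. -/
theorem IsMarking.exists_forest (h : m.IsMarking r N μ ν) :
    ∃ (p : X → D) (ht : X → ℕ), m.IsForest p ht {r}ᶜ ∧
      (fun x => m.edge (p x)) '' {r}ᶜ = μ '' {r}ᶜ := by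
  have : Finite E := Finite.of_surjective _ m.edge_surj
  obtain ⟨p, ht, hp, hpB⟩ := m.exists_forest (μ '' {r}ᶜ) r
  have hp' : m.IsForest p ht {r}ᶜ := hp.mono fun x hx => ⟨h.reachable x, hx⟩
  refine ⟨p, ht, hp', Set.eq_of_subset_of_ncard_le ?_ ?_⟩
  · rintro _ ⟨x, hx, rfl⟩
    exact hpB x (h.reachable x) hx
  · rw [hp'.injOn.ncard_image, h.injOn_vert.ncard_image]

/-- A spanning tree has only one orientation towards its root. -/
theorem IsForest.eqOn_of_injOn {p : X → D} {ht : X → ℕ} {r : X} (hp : m.IsForest p ht {r}ᶜ)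
    {μ : X → E} (hμ : ∀ x ≠ r, ∃ d, m.vert d = x ∧ m.edge d = μ x) (hinj : InjOn μ {r}ᶜ)
    (hB : μ '' {r}ᶜ ⊆ (fun x => m.edge (p x)) '' {r}ᶜ) :
    EqOn μ (fun x => m.edge (p x)) {r}ᶜ := by
  have : Finite X := Finite.of_surjective _ m.vert_surj
  by_contra hne
  have hex : {x | x ∈ ({r}ᶜ : Set X) ∧ μ x ≠ m.edge (p x)}.Nonempty := by
    by_contra hcon
    exact hne fun x hx => by
      by_contra h1
      exact hcon ⟨x, hx, h1⟩
  obtain ⟨x, ⟨hxr, hx⟩, hmax⟩ := (Set.toFinite _).exists_maximalFor ht _ hex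
  obtain ⟨z, hz, hzx⟩ := hB ⟨x, hxr, rfl⟩
  change m.edge (p z) = μ x at hzx
  obtain ⟨d, hd, hdx⟩ := hμ x hxr
  have hzx' : z ≠ x := by
    rintro rfl
    exact hx hzx.symm
  rcases (m.edge_eq _ _).1 (hzx.trans hdx.symm) with h1 | h1
  · exact hzx' (by rw [← (hp z hz).1, ← h1, hd])
  · have hlt := (hp z hz).2
    rw [← h1, hd] at hlt
    by_cases hzm : μ z = m.edge (p z)
    · exact hzx' (hinj hz hxr (hzm.trans hzx))
    · have := hmax (j := z) ⟨hz, hzm⟩ hlt.le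
      omega

theorem IsMarking.eqOn {μ₁ μ₂ : X → E} {ν₁ : Y → E} (h₁ : m.IsMarking r N μ₁ ν₁)
    (hμ : ∀ x ≠ r, ∃ d, m.vert d = x ∧ m.edge d = μ₂ x) (hinj : InjOn μ₂ {r}ᶜ)
    (hB : μ₂ '' {r}ᶜ ⊆ μ₁ '' {r}ᶜ) : EqOn μ₁ μ₂ {r}ᶜ := by
  obtain ⟨p, ht, hp, hpB⟩ := h₁.exists_forest
  have e1 := hp.eqOn_of_injOn h₁.vert_mem h₁.injOn_vert hpB.symm.subset
  have e2 := hp.eqOn_of_injOn hμ hinj (hB.trans hpB.symm.subset)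
  exact fun x hx => (e1 hx).trans (e2 hx).symm

/-- The edges not marked by the vertices form a spanning tree of the dual, and `κ` orients it towards
an arbitrary root `y₀`. -/
theorem IsMarking.exists_dual (h : m.IsMarking r N μ ν) (y₀ : Y) :
    ∃ κ : Y → E, (∀ y ≠ y₀, (∃ d, m.face d = y ∧ m.edge d = κ y) ∧ κ y ∉ μ '' {r}ᶜ) ∧
      InjOn κ {y₀}ᶜ ∧ ∀ e ∉ μ '' {r}ᶜ, ∃ y ≠ y₀, κ y = e := by
  have : Finite X := Finite.of_surjective _ m.vert_surj
  have : Finite E := Finite.of_surjective _ m.edge_surj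
  have : Finite Y := Finite.of_surjective _ m.face_surj
  obtain ⟨p, ht, hp, hpB⟩ := h.exists_forest
  have hall : ∀ y, (m.dual.linkGraph (μ '' {r}ᶜ)ᶜ).Reachable y y₀ := fun y => by
    rw [← hpB]; exact hp.reachable_dual y y₀
  obtain ⟨q, ht', hq, hqB⟩ := m.dual.exists_forest (μ '' {r}ᶜ)ᶜ y₀
  have hq' : m.dual.IsForest q ht' {y₀}ᶜ := hq.mono fun y hy => ⟨hall y, hy⟩
  refine ⟨fun y => m.edge (q y), fun y hy => ⟨⟨q y, (hq' y hy).1, rfl⟩, hqB y (hall y) hy⟩,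
    hq'.injOn, ?_⟩
  have hsub : (fun y => m.edge (q y)) '' {y₀}ᶜ ⊆ (μ '' {r}ᶜ)ᶜ := by
    rintro _ ⟨y, hy, rfl⟩
    exact hqB y (hall y) hy
  have heq : (fun y => m.edge (q y)) '' {y₀}ᶜ = (μ '' {r}ᶜ)ᶜ := by
    refine Set.eq_of_subset_of_ncard_le hsub ?_
    have h1 := Set.ncard_add_ncard_compl (μ '' {r}ᶜ)
    have h2 := Set.ncard_add_ncard_compl ({r} : Set X)
    have h3 := Set.ncard_add_ncard_compl ({y₀} : Set Y)
    have h4 := m.euler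
    have h5 : ((fun y => m.edge (q y)) '' {y₀}ᶜ).ncard = ({y₀}ᶜ : Set Y).ncard :=
      hq'.injOn.ncard_image
    rw [h.injOn_vert.ncard_image] at h1
    rw [Set.ncard_singleton] at h2 h3
    omega
  intro e he
  obtain ⟨y, hy, hye⟩ := heq.symm.subset he
  exact ⟨y, hy, hye⟩

end Marking

end SphereMap

/-! ### The sphere map of a plane graph and its boundary paths -/

namespace PlaneGraph

variable {V : Type*} (P : PlaneGraph V)

instance finite_dart [Finite V] : Finite P.graph.Dart :=
  Finite.of_injective _ SimpleGraph.Dart.toProd_injective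

/-- The edge of a dart. -/
def dartEdge (d : P.graph.Dart) : P.graph.edgeSet := ⟨d.edge, d.edge_mem⟩

theorem exists_dart_fst (x : V) : ∃ d : P.graph.Dart, d.fst = x := by
  have : Nontrivial V := ⟨_, _, P.outerDart.fst_ne_snd⟩
  obtain ⟨y, hy⟩ := P.connected.preconnected.exists_adj_of_nontrivial x
  exact ⟨⟨(x, y), hy⟩, rfl⟩

theorem rot_sameCycle_iff (d d' : P.graph.Dart) : d.fst = d'.fst ↔ P.rot.SameCycle d d' := by
  refine ⟨P.rot_sameCycle d d', ?_⟩
  rintro ⟨k, rfl⟩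
  have h1 : ∀ d, (P.rot⁻¹ d).fst = d.fst := fun d => by
    rw [← P.rot_fst (P.rot⁻¹ d)]; simp
  induction k with
  | zero => simp
  | succ k ih => rw [add_comm, zpow_one_add, Equiv.Perm.mul_apply, P.rot_fst, ih]
  | pred k ih => rw [sub_eq_neg_add, zpow_add, zpow_neg_one, Equiv.Perm.mul_apply, h1, ih]

theorem eq_univ_of_closed (S : Set P.graph.Dart) (hS : S.Nonempty)
    (hsymm : ∀ d ∈ S, d.symm ∈ S) (hrot : ∀ d ∈ S, P.rot d ∈ S) [Finite V] : S = univ := by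
  obtain ⟨d₀, hd₀⟩ := hS
  have hfst : ∀ d ∈ S, ∀ d' : P.graph.Dart, d'.fst = d.fst → d' ∈ S := by
    intro d hd d' hd'
    obtain ⟨k, -, rfl⟩ := (P.rot_sameCycle d d' hd'.symm).exists_pow_eq'
    clear hd'
    induction k with
    | zero => simpa
    | succ k ih => rw [pow_succ', Equiv.Perm.mul_apply]; exact hrot _ ih
  have hwalk : ∀ x y, P.graph.Walk x y → (∀ d : P.graph.Dart, d.fst = y → d ∈ S) →
      ∀ d : P.graph.Dart, d.fst = x → d ∈ S := by
    intro x y W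
    induction W with
    | nil => exact id
    | cons hadj W ih =>
      intro hy d hd
      have h1 := ih hy ⟨(_, _), hadj.symm⟩ rfl
      exact hfst _ (hsymm _ h1) d hd
  ext d
  obtain ⟨W⟩ := P.connected.preconnected d.fst d₀.fst
  exact ⟨fun _ => mem_univ _, fun _ => hwalk _ _ W (hfst d₀ hd₀) d rfl⟩

/-- A finite plane graph as a cell decomposition of the sphere; the infinite face is one of the faces. -/
def sphereMap [Finite V] : SphereMap P.graph.Dart V P.graph.edgeSet P.Face where
  rev := SimpleGraph.Dart.symm
  rev_rev := SimpleGraph.Dart.symm_symm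
  rotV := P.rot
  rotF := P.faceNext
  rotF_apply := P.faceNext_apply
  vert d := d.fst
  edge := P.dartEdge
  face := P.faceOf
  vert_surj := P.exists_dart_fst
  edge_surj := by
    rintro ⟨e, he⟩
    induction e with
    | _ x y => exact ⟨⟨(x, y), he⟩, rfl⟩
  face_surj := Quotient.mk_surjective
  vert_eq := P.rot_sameCycle_iff
  edge_eq d d' := by
    rw [dartEdge, dartEdge, Subtype.mk.injEq, eq_comm, SimpleGraph.dart_edge_eq_iff]
  face_eq d d' := Quotient.eq
  conn S h1 h2 h3 := P.eq_univ_of_closed S h1 h2 h3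
  euler := P.euler

theorem exists_dart_iff_mem {x : V} {e : P.graph.edgeSet} :
    (∃ d : P.graph.Dart, d.fst = x ∧ P.dartEdge d = e) ↔ x ∈ e.1 := by
  constructor
  · rintro ⟨d, rfl, rfl⟩
    exact Sym2.mem_mk_left _ _
  · intro hx
    obtain ⟨e, he⟩ := e
    obtain ⟨y, rfl⟩ := hx
    exact ⟨⟨(x, y), he⟩, rfl, rfl⟩

theorem exists_dart_iff_edgeOn {g : P.Face} {e : P.graph.edgeSet} :
    (∃ d : P.graph.Dart, P.faceOf d = g ∧ P.dartEdge d = e) ↔ P.EdgeOn e g :=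
  ⟨fun ⟨d, h1, h2⟩ => ⟨d, congrArg Subtype.val h2, h1⟩,
    fun ⟨d, h1, h2⟩ => ⟨d, h2, Subtype.ext h1⟩⟩

theorem edgeOn_dartEdge {d : P.graph.Dart} {g : P.Face} :
    P.EdgeOn (P.dartEdge d) g ↔ P.faceOf d = g ∨ P.faceOf d.symm = g := by
  constructor
  · rintro ⟨d', h1, rfl⟩
    rcases (SimpleGraph.dart_edge_eq_iff _ _).1 h1 with rfl | rfl
    · exact Or.inl rfl
    · exact Or.inr rfl
  · rintro (h | h)
    · exact ⟨d, rfl, h⟩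
    · exact ⟨d.symm, by simp [dartEdge], h⟩

theorem faceOf_rot (d : P.graph.Dart) : P.faceOf (P.rot d) = P.faceOf d.symm := by
  refine Quotient.sound (Equiv.Perm.SameCycle.symm ⟨1, ?_⟩)
  rw [zpow_one, P.faceNext_apply, SimpleGraph.Dart.symm_symm]

/-- At a vertex of degree two that lies on two different faces, each of the two edges separates
these faces. -/
theorem exists_dart_of_degree_two {x y : V} (hx : (P.graph.neighborSet x).ncard = 2)
    {g g' : P.Face} (hg : P.VertexOn x g) (hg' : P.VertexOn x g') (hne : g ≠ g')
    (hxy : P.graph.Adj x y) :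
    ∃ d : P.graph.Dart, d.edge = s(x, y) ∧ P.faceOf d = g ∧ P.faceOf d.symm = g' := by
  obtain ⟨a, rfl, ha⟩ := hg
  obtain ⟨b, hbx, hb⟩ := hg'
  have hab : a ≠ b := by
    rintro rfl
    exact hne (ha.symm.trans hb)
  have hdart : ∀ d d' : P.graph.Dart, d.fst = d'.fst → d.snd = d'.snd → d = d' :=
    fun d d' h1 h2 => SimpleGraph.Dart.ext _ _ (Prod.ext h1 h2)
  have hab2 : a.snd ≠ b.snd := fun h => hab (hdart _ _ hbx.symm h)
  have hset : P.graph.neighborSet a.fst = {a.snd, b.snd} := by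
    symm
    refine Set.eq_of_subset_of_ncard_le ?_ ?_ (Set.finite_of_ncard_ne_zero (by omega))
    · rintro z (rfl | rfl)
      · exact a.adj
      · change P.graph.Adj a.fst b.snd
        rw [← hbx]; exact b.adj
    · rw [hx, Set.ncard_pair hab2]
  have hcases : ∀ d : P.graph.Dart, d.fst = a.fst → d = a ∨ d = b := by
    intro d hd
    have : d.snd ∈ P.graph.neighborSet a.fst := by
      change P.graph.Adj a.fst d.snd
      rw [← hd]; exact d.adj
    rw [hset] at this
    rcases this with h | h
    · exact Or.inl (hdart _ _ hd h)
    · exact Or.inr (hdart _ _ (hd.trans hbx.symm) h)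
  have hfix : ∀ c c' : P.graph.Dart, c ≠ c' → c.fst = c'.fst → P.rot c ≠ c := by
    intro c c' hcc hf h
    obtain ⟨k, hk⟩ := P.rot_sameCycle c c' hf
    rw [Equiv.Perm.zpow_apply_eq_self_of_apply_eq_self h] at hk
    exact hcc hk
  have hra : P.rot a = b :=
    (hcases _ (P.rot_fst a)).resolve_left (hfix a b hab hbx.symm)
  have hrb : P.rot b = a :=
    (hcases _ ((P.rot_fst b).trans hbx)).resolve_right (hfix b a hab.symm hbx)
  have hy : y ∈ P.graph.neighborSet a.fst := hxy
  rw [hset] at hy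
  rcases hy with rfl | hy
  · exact ⟨a, rfl, ha, by rw [← P.faceOf_rot, hra, hb]⟩
  · refine ⟨b.symm, ?_, by rw [← P.faceOf_rot, hrb, ha], by rw [SimpleGraph.Dart.symm_symm, hb]⟩
    rw [SimpleGraph.Dart.edge_symm, hy, ← hbx]; rfl

/-- One of the two paths along the boundary of the infinite face, with its vertices of even index of
degree two and belonging to the bounded faces `f k`. -/
structure IsTrack {n : ℕ} (v : Fin (2 * n + 1) → V) (f : Fin n → P.BoundedFace) : Prop where
  injective : Function.Injective v
  adj : ∀ i : Fin (2 * n), P.graph.Adj (v i.castSucc) (v i.succ)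
  vertexOn_outer : ∀ i, P.VertexOn (v i) P.outer
  degree_two : ∀ k, (P.graph.neighborSet (v (evenPos k))).ncard = 2
  on_face : ∀ k, P.VertexOn (v (evenPos k)) (f k).1
  injective_face : Function.Injective f

theorem InCyclicOrder.vertexOn_outer {m : ℕ} {c : Fin m → V} (h : P.InCyclicOrder c) (k : Fin m) :
    P.VertexOn (c k) P.outer := by
  obtain ⟨-, d, hd, p, -, hp⟩ := h
  refine ⟨_, (hp k).2, ?_⟩
  rw [← hd]
  exact Quotient.sound (Equiv.Perm.SameCycle.symm ⟨p k, by simp⟩)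

variable {P} {n : ℕ} {v v' : Fin (2 * n + 1) → V} {f f' : Fin n → P.BoundedFace}

theorem IsAdmissible.isTrack (h : P.IsAdmissible v v' f f') : P.IsTrack v f where
  injective := h.path.1
  adj := h.path.2
  vertexOn_outer i := by
    have := h.cyclic.vertexOn_outer P (Fin.castAdd _ i)
    rwa [Fin.append_left] at this
  degree_two k := (h.degree_two k).1
  on_face k := (h.on_face k).1
  injective_face := h.faces_distinct.comp Sum.inl_injective

theorem IsAdmissible.isTrack' (h : P.IsAdmissible v v' f f') : P.IsTrack v' f' where
  injective := h.path'.1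
  adj := h.path'.2
  vertexOn_outer i := by
    have := h.cyclic.vertexOn_outer P (Fin.natAdd _ i.rev)
    rwa [Fin.append_right, Fin.rev_rev] at this
  degree_two k := (h.degree_two k).2
  on_face k := (h.on_face k).2
  injective_face := h.faces_distinct.comp Sum.inr_injective

theorem IsAdmissible.ne (h : P.IsAdmissible v v' f f') (i j : Fin (2 * n + 1)) : v i ≠ v' j := by
  intro hij
  have h1 := h.cyclic.1 (a₁ := Fin.castAdd _ i) (a₂ := Fin.natAdd _ j.rev)
    (by rw [Fin.append_left, Fin.append_right, Fin.rev_rev, hij])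
  have h2 := congrArg Fin.val h1
  simp only [Fin.val_castAdd, Fin.val_natAdd] at h2
  omega

/-- The position of the edge before the vertex at position `evenPos k`. -/
def loPos (k : Fin n) : Fin (2 * n) := ⟨2 * k.1, by omega⟩

/-- The position of the edge after the vertex at position `evenPos k`. -/
def hiPos (k : Fin n) : Fin (2 * n) := ⟨2 * k.1 + 1, by omega⟩

theorem succ_loPos (k : Fin n) : (loPos k).succ = evenPos k := rfl

theorem castSucc_hiPos (k : Fin n) : (hiPos k).castSucc = evenPos k := rfl

theorem eq_loPos_or_eq_hiPos (i : Fin (2 * n)) : ∃ k, i = loPos k ∨ i = hiPos k := by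
  refine ⟨⟨i.1 / 2, by omega⟩, ?_⟩
  rcases Nat.mod_two_eq_zero_or_one i.1 with h | h
  · left; ext; simp only [loPos]; omega
  · right; ext; simp only [hiPos]; omega

theorem loPos_ne_hiPos (k l : Fin n) : loPos k ≠ hiPos l := by
  intro h
  have := congrArg Fin.val h
  simp only [loPos, hiPos] at this
  omega

theorem hiPos_injective : Function.Injective (hiPos : Fin n → _) := by
  intro k l h
  have := congrArg Fin.val h
  simp only [hiPos] at this
  omega

theorem loPos_injective : Function.Injective (loPos : Fin n → _) := by
  intro k l h
  have := congrArg Fin.val h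
  simp only [loPos] at this
  omega

namespace IsTrack

/-- The edge from `v i` to `v (i + 1)`. -/
def pathEdge (h : P.IsTrack v f) (i : Fin (2 * n)) : P.graph.edgeSet :=
  ⟨s(v i.castSucc, v i.succ), h.adj i⟩

variable (h : P.IsTrack v f)

theorem mem_pathEdge {x : V} {i : Fin (2 * n)} :
    x ∈ (h.pathEdge i).1 ↔ x = v i.castSucc ∨ x = v i.succ := Sym2.mem_iff

theorem pathEdge_injective : Function.Injective h.pathEdge := by
  intro i j hij
  have h1 := congrArg Subtype.val hij
  simp only [pathEdge, Sym2.eq_iff, h.injective.eq_iff, Fin.ext_iff, Fin.val_castSucc,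
    Fin.val_succ] at h1
  ext
  omega

theorem eq_pathEdge {k : Fin n} {e : P.graph.edgeSet} (he : v (evenPos k) ∈ e.1) :
    e = h.pathEdge (loPos k) ∨ e = h.pathEdge (hiPos k) := by
  obtain ⟨e, hadj⟩ := e
  obtain ⟨y, rfl⟩ := he
  have h1 := h.adj (loPos k)
  have h2 := h.adj (hiPos k)
  rw [succ_loPos] at h1
  rw [castSucc_hiPos] at h2
  have hne : v (loPos k).castSucc ≠ v (hiPos k).succ := by
    intro h3
    have := congrArg Fin.val (h.injective h3)
    simp only [loPos, hiPos, Fin.val_castSucc, Fin.val_succ] at this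
    omega
  have hset : {v (loPos k).castSucc, v (hiPos k).succ} = P.graph.neighborSet (v (evenPos k)) := by
    refine Set.eq_of_subset_of_ncard_le ?_ ?_
      (Set.finite_of_ncard_ne_zero (by rw [h.degree_two k]; omega))
    · rintro z (rfl | rfl)
      · exact h1.symm
      · exact h2
    · rw [h.degree_two k, Set.ncard_pair hne]
  have hy : y ∈ P.graph.neighborSet (v (evenPos k)) := hadj
  rw [← hset] at hy
  rcases hy with rfl | rfl
  · left
    exact Subtype.ext Sym2.eq_swap
  · right
    rfl

theorem exists_dart_pathEdge {k : Fin n} {i : Fin (2 * n)} (hi : i = loPos k ∨ i = hiPos k) :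
    ∃ d : P.graph.Dart, P.dartEdge d = h.pathEdge i ∧ P.faceOf d = P.outer ∧
      P.faceOf d.symm = (f k).1 := by
  have key := fun y => P.exists_dart_of_degree_two (y := y) (h.degree_two k)
    (h.vertexOn_outer (evenPos k)) (h.on_face k) (f k).2.symm
  rcases hi with rfl | rfl
  · obtain ⟨d, hd, h1, h2⟩ := key _ (h.adj (loPos k)).symm
    exact ⟨d, Subtype.ext (hd.trans Sym2.eq_swap), h1, h2⟩
  · obtain ⟨d, hd, h1, h2⟩ := key _ (h.adj (hiPos k))
    exact ⟨d, Subtype.ext hd, h1, h2⟩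

theorem edgeOn_pathEdge {k : Fin n} {i : Fin (2 * n)} (hi : i = loPos k ∨ i = hiPos k)
    {g : P.Face} : P.EdgeOn (h.pathEdge i) g ↔ g = P.outer ∨ g = (f k).1 := by
  obtain ⟨d, hd, h1, h2⟩ := h.exists_dart_pathEdge hi
  rw [← hd, P.edgeOn_dartEdge, h1, h2, eq_comm, eq_comm (b := g)]

end IsTrack

end PlaneGraph

/-! ### Reorienting the trees of a matching -/

namespace PlaneGraph

variable {V : Type*} {P : PlaneGraph V} {n : ℕ} {v v' : Fin (2 * n + 1) → V}
  {f f' : Fin n → P.BoundedFace}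

/-- Two disjoint boundary paths with disjoint families of faces. Unlike the cyclic order condition,
this is visibly symmetric. -/
structure IsTrackPair (P : PlaneGraph V) (v v' : Fin (2 * n + 1) → V)
    (f f' : Fin n → P.BoundedFace) : Prop where
  left : P.IsTrack v f
  right : P.IsTrack v' f'
  ne : ∀ i j, v i ≠ v' j
  face_ne : ∀ k l, f k ≠ f' l

theorem IsTrackPair.symm (H : P.IsTrackPair v v' f f') : P.IsTrackPair v' v f' f :=
  ⟨H.right, H.left, fun i j h => H.ne j i h.symm, fun k l h => H.face_ne l k h.symm⟩

theorem IsAdmissible.isTrackPair (h : P.IsAdmissible v v' f f') : P.IsTrackPair v v' f f' :=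
  ⟨h.isTrack, h.isTrack', h.ne, fun k l hkl =>
    Sum.inl_ne_inr (h.faces_distinct (a₁ := Sum.inl k) (a₂ := Sum.inr l) hkl)⟩

/-- The vertices of the graph that remain when the vertices with even index of both paths and the
terminals on the path `v` are removed. -/
def freeVert (v v' : Fin (2 * n + 1) → V) : Set V :=
  {x | (∀ i, v i ≠ x) ∧ ∀ k : Fin n, v' (evenPos k) ≠ x}

/-- The bounded faces other than the `f k`. -/
def freeFace (f : Fin n → P.BoundedFace) : Set P.Face :=
  {g | g ≠ P.outer ∧ ∀ k, (f k).1 ≠ g}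

/-- The edges that remain after smashing in the vertices with even index. All edges at these vertices
are on the infinite face, so that this condition need not be mentioned. -/
def freeEdge (P : PlaneGraph V) (v v' : Fin (2 * n + 1) → V) : Set P.graph.edgeSet :=
  {e | ∀ k : Fin n, v (evenPos k) ∉ e.1 ∧ v' (evenPos k) ∉ e.1}

theorem freeEdge_comm : P.freeEdge v v' = P.freeEdge v' v := by
  ext e
  exact forall_congr' fun k => and_comm

theorem IsTrack.exists_evenPos_mem (h : P.IsTrack v f) (i : Fin (2 * n)) :
    ∃ k, v (evenPos k) ∈ (h.pathEdge i).1 := by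
  obtain ⟨k, rfl | rfl⟩ := eq_loPos_or_eq_hiPos i
  · exact ⟨k, h.mem_pathEdge.2 (Or.inr rfl)⟩
  · exact ⟨k, h.mem_pathEdge.2 (Or.inl rfl)⟩

namespace IsTrackPair

theorem pathEdge_notMem (H : P.IsTrackPair v v' f f') (i : Fin (2 * n)) :
    H.left.pathEdge i ∉ P.freeEdge v v' := fun h =>
  let ⟨k, hk⟩ := H.left.exists_evenPos_mem i
  (h k).1 hk

theorem pathEdge'_notMem (H : P.IsTrackPair v v' f f') (i : Fin (2 * n)) :
    H.right.pathEdge i ∉ P.freeEdge v v' := fun h =>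
  let ⟨k, hk⟩ := H.right.exists_evenPos_mem i
  (h k).2 hk

theorem mem_freeEdge (H : P.IsTrackPair v v' f f') {e : P.graph.edgeSet}
    (h : ∀ i, e ≠ H.left.pathEdge i) (h' : ∀ i, e ≠ H.right.pathEdge i) : e ∈ P.freeEdge v v' := by
  refine fun k => ⟨fun hk => ?_, fun hk => ?_⟩
  · rcases H.left.eq_pathEdge hk with he | he
    · exact h _ he
    · exact h _ he
  · rcases H.right.eq_pathEdge hk with he | he
    · exact h' _ he
    · exact h' _ he

theorem pathEdge_ne (H : P.IsTrackPair v v' f f') (i j : Fin (2 * n)) :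
    H.left.pathEdge i ≠ H.right.pathEdge j := by
  intro h
  have h1 : v i.succ ∈ (H.right.pathEdge j).1 := by
    rw [← h]; exact H.left.mem_pathEdge.2 (Or.inr rfl)
  rcases H.right.mem_pathEdge.1 h1 with h2 | h2
  · exact H.ne _ _ h2
  · exact H.ne _ _ h2

end IsTrackPair

/-- A perfect matching of the smashed dual refinement without the terminals on the path `v`, encoded
by the edges `mX x` and `mY g` to which vertices and faces are matched. The functions are total; only
their values on `freeVert v v'` and on `freeFace f` matter. -/
structure IsOrientation (P : PlaneGraph V) (v v' : Fin (2 * n + 1) → V)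
    (f : Fin n → P.BoundedFace) (mX : V → P.graph.edgeSet) (mY : P.Face → P.graph.edgeSet) :
    Prop where
  vert_mem : ∀ x ∈ freeVert v v', x ∈ (mX x).1
  vert_free : MapsTo mX (freeVert v v') (P.freeEdge v v')
  face_mem : ∀ g ∈ freeFace f, P.EdgeOn (mY g) g
  face_free : MapsTo mY (freeFace f) (P.freeEdge v v')
  injOn_vert : InjOn mX (freeVert v v')
  injOn_face : InjOn mY (freeFace f)
  disjoint : ∀ x ∈ freeVert v v', ∀ g ∈ freeFace f, mX x ≠ mY g
  cover : ∀ e ∈ P.freeEdge v v', (∃ x ∈ freeVert v v', mX x = e) ∨ ∃ g ∈ freeFace f, mY g = e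

theorem evenPos_injective : Function.Injective (evenPos : Fin n → _) := by
  intro k l h
  have := congrArg Fin.val h
  simp only [evenPos] at this
  omega

theorem vert_cases (v v' : Fin (2 * n + 1) → V) (x : V) (hx : x ≠ v 0) :
    (∃ i : Fin (2 * n), x = v i.succ) ∨ (∃ k : Fin n, x = v' (evenPos k)) ∨ x ∈ freeVert v v' := by
  by_cases h1 : ∃ i, v i = x
  · obtain ⟨i, rfl⟩ := h1
    refine Or.inl ?_
    induction i using Fin.cases with
    | zero => exact absurd rfl hx
    | succ i => exact ⟨i, rfl⟩
  · by_cases h2 : ∃ k : Fin n, v' (evenPos k) = x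
    · obtain ⟨k, rfl⟩ := h2
      exact Or.inr (Or.inl ⟨k, rfl⟩)
    · push Not at h1 h2
      exact Or.inr (Or.inr ⟨h1, h2⟩)

theorem face_cases (f : Fin n → P.BoundedFace) (g : P.Face) (hg : g ≠ P.outer) :
    (∃ k, g = (f k).1) ∨ g ∈ freeFace f := by
  by_cases h1 : ∃ k, (f k).1 = g
  · obtain ⟨k, rfl⟩ := h1
    exact Or.inl ⟨k, rfl⟩
  · push Not at h1
    exact Or.inr ⟨hg, h1⟩

theorem ne_zero_of_mem_freeVert {x : V} (hx : x ∈ freeVert v v') : x ≠ v 0 := (hx.1 0).symm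

namespace IsTrackPair

variable {mX : V → P.graph.edgeSet} {mY : P.Face → P.graph.edgeSet}

/-- The extension of `mX` to the vertices other than `v 0`: each vertex of the path `v` marks the edge
before it, and so do the vertices with even index of the path `v'`. -/
noncomputable def vertMark (H : P.IsTrackPair v v' f f') (mX : V → P.graph.edgeSet) :
    V → P.graph.edgeSet :=
  Function.extend (fun i : Fin (2 * n) => v i.succ) H.left.pathEdge
    (Function.extend (fun k : Fin n => v' (evenPos k)) (fun k => H.right.pathEdge (loPos k)) mX)

/-- The extension of `mY` to all bounded faces: `f k` marks the edge after `v (evenPos k)`, which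
separates it from the infinite face. -/
noncomputable def faceMark (H : P.IsTrackPair v v' f f') (mY : P.Face → P.graph.edgeSet) :
    P.Face → P.graph.edgeSet :=
  Function.extend (fun k => (f k).1) (fun k => H.left.pathEdge (hiPos k)) mY

theorem vertMark_succ (H : P.IsTrackPair v v' f f') (i : Fin (2 * n)) :
    H.vertMark mX (v i.succ) = H.left.pathEdge i :=
  (H.left.injective.comp (Fin.succ_injective _)).extend_apply _ _ i

theorem vertMark_even (H : P.IsTrackPair v v' f f') (k : Fin n) :
    H.vertMark mX (v' (evenPos k)) = H.right.pathEdge (loPos k) := by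
  rw [vertMark, Function.extend_apply' _ _ _ (fun ⟨i, hi⟩ => H.ne _ _ hi)]
  exact (H.right.injective.comp evenPos_injective).extend_apply _ _ k

theorem vertMark_free (H : P.IsTrackPair v v' f f') {x : V} (hx : x ∈ freeVert v v') :
    H.vertMark mX x = mX x := by
  rw [vertMark, Function.extend_apply' _ _ _ (fun ⟨i, hi⟩ => hx.1 _ hi),
    Function.extend_apply' _ _ _ (fun ⟨i, hi⟩ => hx.2 _ hi)]

theorem faceMark_face (H : P.IsTrackPair v v' f f') (k : Fin n) :
    H.faceMark mY (f k).1 = H.left.pathEdge (hiPos k) :=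
  (Subtype.val_injective.comp H.left.injective_face).extend_apply _ _ k

theorem faceMark_free (H : P.IsTrackPair v v' f f') {g : P.Face} (hg : g ∈ freeFace f) :
    H.faceMark mY g = mY g := by
  rw [faceMark, Function.extend_apply' _ _ _ (fun ⟨i, hi⟩ => hg.2 _ hi)]

theorem image_vertMark (H : P.IsTrackPair v v' f f') (e : P.graph.edgeSet) :
    e ∈ H.vertMark mX '' {v 0}ᶜ ↔ (∃ i, e = H.left.pathEdge i) ∨
      (∃ k, e = H.right.pathEdge (loPos k)) ∨ e ∈ mX '' freeVert v v' := by
  constructor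
  · rintro ⟨x, hx, rfl⟩
    rcases vert_cases v v' x hx with ⟨i, rfl⟩ | ⟨k, rfl⟩ | hx
    · exact Or.inl ⟨i, H.vertMark_succ i⟩
    · exact Or.inr (Or.inl ⟨k, H.vertMark_even k⟩)
    · exact Or.inr (Or.inr ⟨x, hx, (H.vertMark_free hx).symm⟩)
  · rintro (⟨i, rfl⟩ | ⟨k, rfl⟩ | ⟨x, hx, rfl⟩)
    · exact ⟨v i.succ, fun h => Fin.succ_ne_zero i (H.left.injective h), H.vertMark_succ i⟩
    · exact ⟨v' (evenPos k), fun h => H.ne _ _ (Eq.symm h), H.vertMark_even k⟩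
    · exact ⟨x, ne_zero_of_mem_freeVert hx, H.vertMark_free hx⟩

theorem image_faceMark (H : P.IsTrackPair v v' f f') (e : P.graph.edgeSet) :
    e ∈ H.faceMark mY '' {P.outer}ᶜ ↔ (∃ k, e = H.left.pathEdge (hiPos k)) ∨
      e ∈ mY '' freeFace f := by
  constructor
  · rintro ⟨g, hg, rfl⟩
    rcases face_cases f g hg with ⟨k, rfl⟩ | hg
    · exact Or.inl ⟨k, H.faceMark_face k⟩
    · exact Or.inr ⟨g, hg, (H.faceMark_free hg).symm⟩
  · rintro (⟨k, rfl⟩ | ⟨g, hg, rfl⟩)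
    · exact ⟨(f k).1, (f k).2, H.faceMark_face k⟩
    · exact ⟨g, hg.1, H.faceMark_free hg⟩

theorem mem_vertMark (H : P.IsTrackPair v v' f f') (h : P.IsOrientation v v' f mX mY) (x : V)
    (hx : x ≠ v 0) : x ∈ (H.vertMark mX x).1 := by
  rcases vert_cases v v' x hx with ⟨i, rfl⟩ | ⟨k, rfl⟩ | hx
  · rw [H.vertMark_succ]; exact H.left.mem_pathEdge.2 (Or.inr rfl)
  · rw [H.vertMark_even]; exact H.right.mem_pathEdge.2 (Or.inr rfl)
  · rw [H.vertMark_free hx]; exact h.vert_mem x hx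

theorem edgeOn_faceMark (H : P.IsTrackPair v v' f f') (h : P.IsOrientation v v' f mX mY)
    (g : P.Face) (hg : g ≠ P.outer) : P.EdgeOn (H.faceMark mY g) g := by
  rcases face_cases f g hg with ⟨k, rfl⟩ | hg
  · rw [H.faceMark_face]; exact (H.left.edgeOn_pathEdge (Or.inr rfl)).2 (Or.inr rfl)
  · rw [H.faceMark_free hg]; exact h.face_mem g hg

theorem injOn_vertMark (H : P.IsTrackPair v v' f f') (h : P.IsOrientation v v' f mX mY) :
    InjOn (H.vertMark mX) {v 0}ᶜ := by
  intro x hx y hy hxy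
  rcases vert_cases v v' x hx with ⟨i, rfl⟩ | ⟨k, rfl⟩ | hx <;>
  rcases vert_cases v v' y hy with ⟨j, rfl⟩ | ⟨l, rfl⟩ | hy <;>
  try simp only [H.vertMark_succ, H.vertMark_even] at hxy
  · rw [H.left.pathEdge_injective hxy]
  · exact absurd hxy (H.pathEdge_ne _ _)
  · rw [H.vertMark_free hy] at hxy
    exact absurd (hxy ▸ h.vert_free hy) (H.pathEdge_notMem _)
  · exact absurd hxy.symm (H.pathEdge_ne _ _)
  · rw [loPos_injective (H.right.pathEdge_injective hxy)]
  · rw [H.vertMark_free hy] at hxy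
    exact absurd (hxy ▸ h.vert_free hy) (H.pathEdge'_notMem _)
  · rw [H.vertMark_free hx] at hxy
    exact absurd (hxy ▸ h.vert_free hx) (H.pathEdge_notMem _)
  · rw [H.vertMark_free hx] at hxy
    exact absurd (hxy ▸ h.vert_free hx) (H.pathEdge'_notMem _)
  · rw [H.vertMark_free hx, H.vertMark_free hy] at hxy
    exact h.injOn_vert hx hy hxy

theorem injOn_faceMark (H : P.IsTrackPair v v' f f') (h : P.IsOrientation v v' f mX mY) :
    InjOn (H.faceMark mY) {P.outer}ᶜ := by
  intro x hx y hy hxy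
  rcases face_cases f x hx with ⟨i, rfl⟩ | hx <;>
  rcases face_cases f y hy with ⟨j, rfl⟩ | hy <;>
  try simp only [H.faceMark_face] at hxy
  · rw [hiPos_injective (H.left.pathEdge_injective hxy)]
  · rw [H.faceMark_free hy] at hxy
    exact absurd (hxy ▸ h.face_free hy) (H.pathEdge_notMem _)
  · rw [H.faceMark_free hx] at hxy
    exact absurd (hxy ▸ h.face_free hx) (H.pathEdge_notMem _)
  · rw [H.faceMark_free hx, H.faceMark_free hy] at hxy
    exact h.injOn_face hx hy hxy

variable [Finite V]

theorem isMarking_face (H : P.IsTrackPair v v' f f') (h : P.IsOrientation v v' f mX mY) :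
    P.sphereMap.dual.IsMarking P.outer (freeVert v v')ᶜ (H.faceMark mY) mX where
  vert_mem g hg := P.exists_dart_iff_edgeOn.2 (H.edgeOn_faceMark h g hg)
  face_mem x hx := P.exists_dart_iff_mem.2 (h.vert_mem x (not_notMem.1 hx))
  injOn_vert := H.injOn_faceMark h
  injOn_face := by rw [compl_compl]; exact h.injOn_vert
  disjoint g hg x hx := by
    have hx := not_notMem.1 hx
    rcases face_cases f g hg with ⟨k, rfl⟩ | hg
    · rw [H.faceMark_face]
      intro h1
      exact H.pathEdge_notMem _ (h1 ▸ h.vert_free hx)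
    · rw [H.faceMark_free hg]
      exact (h.disjoint x hx g hg).symm
  exempt x hx := by
    have hout : P.VertexOn x P.outer := by
      by_cases h0 : x = v 0
      · rw [h0]; exact H.left.vertexOn_outer 0
      · rcases vert_cases v v' x h0 with ⟨i, rfl⟩ | ⟨k, rfl⟩ | hx'
        · exact H.left.vertexOn_outer _
        · exact H.right.vertexOn_outer _
        · exact absurd hx' hx
    obtain ⟨d, hd, hdo⟩ := hout
    refine ⟨d, hd, ?_⟩
    change (SphereMap.linkGraph _ _).Reachable (P.faceOf d) _
    rw [hdo]

theorem isMarking_vert (H : P.IsTrackPair v v' f f') (h : P.IsOrientation v v' f mX mY) :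
    P.sphereMap.IsMarking (v 0) (freeFace f)ᶜ (H.vertMark mX) mY where
  vert_mem x hx := P.exists_dart_iff_mem.2 (H.mem_vertMark h x hx)
  face_mem g hg := P.exists_dart_iff_edgeOn.2 (h.face_mem g (not_notMem.1 hg))
  injOn_vert := H.injOn_vertMark h
  injOn_face := by rw [compl_compl]; exact h.injOn_face
  disjoint x hx g hg := by
    have hg := not_notMem.1 hg
    rcases vert_cases v v' x hx with ⟨i, rfl⟩ | ⟨k, rfl⟩ | hx
    · rw [H.vertMark_succ]
      intro h1
      exact H.pathEdge_notMem _ (h1 ▸ h.face_free hg)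
    · rw [H.vertMark_even]
      intro h1
      exact H.pathEdge'_notMem _ (h1 ▸ h.face_free hg)
    · rw [H.vertMark_free hx]
      exact h.disjoint x hx g hg
  exempt g hg := by
    set B := H.vertMark mX '' {v 0}ᶜ with hB
    have hstep : ∀ i : Fin (2 * n),
        (P.sphereMap.linkGraph B).Reachable (v i.castSucc) (v i.succ) := fun i =>
      P.sphereMap.reachable_rev (d := ⟨(v i.castSucc, v i.succ), H.left.adj i⟩)
        ((H.image_vertMark _).2 (Or.inl ⟨i, rfl⟩))
    have hreach : ∀ i, (P.sphereMap.linkGraph B).Reachable (v i) (v 0) := by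
      intro i
      induction i using Fin.induction with
      | zero => exact SimpleGraph.Reachable.refl _
      | succ i ih => exact (hstep i).symm.trans ih
    have hon : ∃ i, P.VertexOn (v i) g := by
      by_cases h0 : g = P.outer
      · rw [h0]; exact ⟨0, H.left.vertexOn_outer 0⟩
      · rcases face_cases f g h0 with ⟨k, rfl⟩ | hg'
        · exact ⟨_, H.left.on_face k⟩
        · exact absurd hg' hg
    obtain ⟨i, d, hd, hdg⟩ := hon
    refine ⟨d, hdg, ?_⟩
    change (SphereMap.linkGraph _ _).Reachable d.fst _
    rw [hd]
    exact hreach i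

/-- The complements of the two spanning trees, rooted at `v' 0` and at the infinite face, give a
matching that avoids the terminals on the path `v'` instead of those on the path `v`. -/
theorem exists_orientation (H : P.IsTrackPair v v' f f') (h : P.IsOrientation v v' f mX mY) :
    ∃ (mX' : V → P.graph.edgeSet) (mY' : P.Face → P.graph.edgeSet),
      P.IsOrientation v' v f' mX' mY' ∧ mX' '' freeVert v' v = mX '' freeVert v v' := by
  obtain ⟨κ, hκ, hκinj, hκsurj⟩ := (H.isMarking_face h).exists_dual (v' 0)
  obtain ⟨τ, hτ, hτinj, hτsurj⟩ := (H.isMarking_vert h).exists_dual P.outer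
  have hκmem : ∀ x ≠ v' 0, x ∈ (κ x).1 := fun x hx => P.exists_dart_iff_mem.1 (hκ x hx).1
  have hτmem : ∀ g ≠ P.outer, P.EdgeOn (τ g) g := fun g hg => P.exists_dart_iff_edgeOn.1 (hτ g hg).1
  have hκB : ∀ x ≠ v' 0, (∀ k, κ x ≠ H.left.pathEdge (hiPos k)) ∧ κ x ∉ mY '' freeFace f := by
    intro x hx
    have h1 := (hκ x hx).2
    rw [H.image_faceMark] at h1
    push Not at h1
    exact h1
  have hτB : ∀ g ≠ P.outer, (∀ i, τ g ≠ H.left.pathEdge i) ∧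
      (∀ k, τ g ≠ H.right.pathEdge (loPos k)) ∧ τ g ∉ mX '' freeVert v v' := by
    intro g hg
    have h1 := (hτ g hg).2
    rw [H.image_vertMark] at h1
    push Not at h1
    exact h1
  -- the edges at the smashed vertices are marked in the only possible way, so that the other cells
  -- mark edges in `freeEdge`; along the path `v'` this goes by induction from the root `v' 0`
  have hκpath : ∀ i : Fin (2 * n), κ (v' i.succ) = H.right.pathEdge i := by
    intro i
    induction hi : i.1 generalizing i with
    | zero | succ j ih => ?_
    all_goals
      obtain ⟨x, hx, hxi⟩ := hκsurj (H.right.pathEdge i) (by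
        rw [H.image_faceMark]
        rintro (⟨k, hk⟩ | ⟨g, hg, hgi⟩)
        · exact H.pathEdge_ne _ _ hk.symm
        · exact H.pathEdge'_notMem i (hgi ▸ h.face_free hg))
      have hxm := hκmem x hx
      rw [hxi, H.right.mem_pathEdge] at hxm
    · rcases hxm with rfl | rfl
      · exact absurd (congrArg v' (Fin.ext hi)) hx
      · exact hxi
    · rcases hxm with rfl | rfl
      · have h1 := ih ⟨j, by omega⟩ rfl
        have h2 : Fin.succ (⟨j, by omega⟩ : Fin (2 * n)) = i.castSucc := Fin.ext (by simp [hi])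
        rw [h2, hxi] at h1
        have h3 := congrArg Fin.val (H.right.pathEdge_injective h1)
        simp only [hi] at h3
        omega
      · exact hxi
  have hκeven : ∀ k : Fin n, κ (v (evenPos k)) = H.left.pathEdge (loPos k) := fun k =>
    (H.left.eq_pathEdge (hκmem _ (H.ne _ _))).resolve_right ((hκB _ (H.ne _ _)).1 k)
  have hτface : ∀ k, τ (f' k).1 = H.right.pathEdge (hiPos k) := by
    intro k
    obtain ⟨g, hg, hgk⟩ := hτsurj (H.right.pathEdge (hiPos k)) (by
      rw [H.image_vertMark]
      rintro (⟨i, hi⟩ | ⟨l, hl⟩ | ⟨x, hx, hxk⟩)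
      · exact H.pathEdge_ne _ _ hi.symm
      · exact loPos_ne_hiPos _ _ (H.right.pathEdge_injective hl).symm
      · exact H.pathEdge'_notMem _ (hxk ▸ h.vert_free hx))
    have h1 := hτmem g hg
    rw [hgk, H.right.edgeOn_pathEdge (Or.inr rfl)] at h1
    rwa [h1.resolve_left hg] at hgk
  have hκfree : ∀ x ∈ freeVert v' v, κ x ∈ P.freeEdge v v' ∧ κ x ∈ mX '' freeVert v v' := by
    intro x hx
    have hx0 : x ≠ v' 0 := ne_zero_of_mem_freeVert hx
    have h1 : κ x ∈ P.freeEdge v v' := by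
      refine H.mem_freeEdge (fun i hi => ?_) fun i hi => ?_
      · obtain ⟨k, rfl | rfl⟩ := eq_loPos_or_eq_hiPos i
        · exact hx.2 k (hκinj (H.ne _ _) hx0 ((hκeven k).trans hi.symm))
        · exact (hκB x hx0).1 k hi
      · exact hx.1 i.succ (hκinj (fun h => Fin.succ_ne_zero i (H.right.injective h)) hx0
          ((hκpath i).trans hi.symm))
    exact ⟨h1, (h.cover _ h1).resolve_right (hκB x hx0).2⟩
  have hκonto : ∀ e ∈ mX '' freeVert v v', ∃ x ∈ freeVert v' v, κ x = e := by
    rintro _ ⟨z, hz, rfl⟩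
    obtain ⟨x, hx, hxz⟩ := hκsurj (mX z) (by
      rw [H.image_faceMark]
      rintro (⟨k, hk⟩ | ⟨g, hg, hgz⟩)
      · exact H.pathEdge_notMem _ (hk ▸ h.vert_free hz)
      · exact h.disjoint z hz g hg hgz.symm)
    rcases vert_cases v' v x hx with ⟨i, rfl⟩ | ⟨k, rfl⟩ | hxf
    · exact absurd (h.vert_free hz) (by rw [← hxz, hκpath]; exact H.pathEdge'_notMem i)
    · exact absurd (h.vert_free hz) (by rw [← hxz, hκeven]; exact H.pathEdge_notMem _)
    · exact ⟨x, hxf, hxz⟩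
  have hout' : ∀ g ∈ freeFace f', g ≠ P.outer := fun g hg => hg.1
  refine ⟨κ, τ, ⟨fun x hx => hκmem x (ne_zero_of_mem_freeVert hx), fun x hx => ?_,
    fun g hg => hτmem g hg.1, fun g hg => ?_,
    hκinj.mono fun x hx => ne_zero_of_mem_freeVert hx, hτinj.mono hout', ?_, ?_⟩, ?_⟩
  · rw [freeEdge_comm]; exact (hκfree x hx).1
  · rw [freeEdge_comm]
    refine H.mem_freeEdge (hτB g hg.1).1 fun i hi => ?_
    obtain ⟨k, rfl | rfl⟩ := eq_loPos_or_eq_hiPos i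
    · exact (hτB g hg.1).2.1 k hi
    · exact hg.2 k (hτinj (f' k).2 hg.1 ((hτface k).trans hi.symm))
  · intro x hx g hg hxg
    exact (hτB g hg.1).2.2 (hxg ▸ (hκfree x hx).2)
  · intro e he
    rw [freeEdge_comm] at he
    by_cases heF : e ∈ mX '' freeVert v v'
    · exact Or.inl (hκonto e heF)
    · right
      obtain ⟨g, hg, hge⟩ := hτsurj e (by
        rw [H.image_vertMark]
        rintro (⟨i, rfl⟩ | ⟨k, rfl⟩ | h1)
        · exact H.pathEdge_notMem i he
        · exact H.pathEdge'_notMem _ he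
        · exact heF h1)
      rcases face_cases f' g hg with ⟨k, rfl⟩ | hgf
      · exact absurd he (by rw [← hge, hτface]; exact H.pathEdge'_notMem _)
      · exact ⟨g, hgf, hge⟩
  · ext e
    exact ⟨fun ⟨x, hx, hxe⟩ => hxe ▸ (hκfree x hx).2, fun he => hκonto e he⟩

/-- A matching is determined by the set of the edges that are matched to vertices of the graph. -/
theorem orientation_unique (H : P.IsTrackPair v v' f f') {mX₂ : V → P.graph.edgeSet}
    {mY₂ : P.Face → P.graph.edgeSet} (h : P.IsOrientation v v' f mX mY)
    (h₂ : P.IsOrientation v v' f mX₂ mY₂)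
    (himg : mX '' freeVert v v' = mX₂ '' freeVert v v') :
    EqOn mX mX₂ (freeVert v v') ∧ EqOn mY mY₂ (freeFace f) := by
  have hface : mY₂ '' freeFace f ⊆ mY '' freeFace f := by
    rintro _ ⟨g, hg, rfl⟩
    refine (h.cover _ (h₂.face_free hg)).resolve_left fun h1 => ?_
    obtain ⟨x, hx, hxg⟩ : mY₂ g ∈ mX₂ '' freeVert v v' := himg ▸ h1
    exact h₂.disjoint x hx g hg hxg
  have e1 := (H.isMarking_vert h).eqOn (H.isMarking_vert h₂).vert_mem (H.injOn_vertMark h₂) (by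
    intro e he
    rw [H.image_vertMark] at he ⊢
    rwa [himg])
  have e2 := (H.isMarking_face h).eqOn (H.isMarking_face h₂).vert_mem (H.injOn_faceMark h₂) (by
    intro e he
    rw [H.image_faceMark] at he ⊢
    exact he.imp_right fun h1 => hface h1)
  refine ⟨fun x hx => ?_, fun g hg => ?_⟩
  · have := e1 (ne_zero_of_mem_freeVert hx)
    rwa [H.vertMark_free hx, H.vertMark_free hx] at this
  · have := e2 hg.1
    rwa [H.faceMark_free hg, H.faceMark_free hg] at this

end IsTrackPair

end PlaneGraph

/-! ### Perfect matchings of paths -/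

namespace SimpleGraph

variable {W : Type*} {H : SimpleGraph W} {s t : W}

/-- The matching of a path without its starting point pairs each vertex at odd distance from the
starting point with the next one. -/
theorem Subgraph.ContainsPathMatching.adj {M : H.Subgraph} {p : H.Walk s t}
    (h : M.ContainsPathMatching p s) (hp : p.IsPath) (j : ℕ) (hj : 2 * j + 1 < p.length) :
    M.Adj (p.getVert (2 * j + 1)) (p.getVert (2 * j + 2)) := by
  obtain ⟨N, ⟨hNle, hNm, hNv⟩, hNM⟩ := h
  refine hNM.2 ?_
  have hinj : ∀ {a b}, a ≤ p.length → b ≤ p.length → p.getVert a = p.getVert b → a = b :=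
    fun ha hb hab => hp.getVert_injOn ha hb hab
  induction j with
  | zero | succ l ih => ?_
  all_goals
    have hmem : ∀ l, 0 < l → l ≤ p.length → p.getVert l ∈ N.verts := by
      intro l hl0 hl
      rw [hNv, Subgraph.deleteVerts_verts, Walk.verts_toSubgraph]
      refine ⟨p.getVert_mem_support _, fun h0 => ?_⟩
      have := hinj hl (Nat.zero_le _) (h0.trans p.getVert_zero.symm)
      omega
    obtain ⟨u, hu, -⟩ := hNm (hmem _ (Nat.succ_pos _) hj.le)
    have hadj := hNle.2 hu
    rw [Subgraph.deleteVerts_adj, Walk.toSubgraph_adj_iff] at hadj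
    obtain ⟨-, -, -, hus, i, hi, hil⟩ := hadj
    rcases Sym2.eq_iff.1 hi with ⟨h1, rfl⟩ | ⟨h1, h2⟩
    · have := hinj hil.le hj.le h1
      rwa [this] at hu
  · have := hinj hil hj.le h2
    obtain rfl : i = 0 := by omega
    exact absurd (h1.symm.trans p.getVert_zero) hus
  · have h3 := hinj hil hj.le h2
    obtain rfl : i = 2 * l + 2 := by omega
    rw [← h1] at hu
    have h4 := (hNm.eq_of_adj_left hu.symm (ih (by omega)).symm)
    have := hinj hj.le (by omega) h4
    omega

theorem Subgraph.containsPathMatching_of_adj {M : H.Subgraph} {p : H.Walk s t} (hp : p.IsPath)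
    {L : ℕ} (hL : p.length = 2 * L)
    (h : ∀ j < L, M.Adj (p.getVert (2 * j)) (p.getVert (2 * j + 1))) :
    M.ContainsPathMatching p t := by
  have hinj : ∀ {a b}, a ≤ p.length → b ≤ p.length → p.getVert a = p.getVert b → a = b :=
    fun ha hb hab => hp.getVert_injOn ha hb hab
  let N : H.Subgraph :=
    { verts := {a | ∃ i < p.length, p.getVert i = a}
      Adj := fun a b => ∃ j < L, s(p.getVert (2 * j), p.getVert (2 * j + 1)) = s(a, b)
      adj_sub := by
        rintro a b ⟨j, hj, hab⟩
        have := p.adj_getVert_succ (i := 2 * j) (by omega)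
        rwa [← SimpleGraph.mem_edgeSet, hab] at this
      edge_vert := by
        rintro a b ⟨j, hj, hab⟩
        rcases Sym2.eq_iff.1 hab with ⟨rfl, rfl⟩ | ⟨rfl, rfl⟩
        · exact ⟨_, by omega, rfl⟩
        · exact ⟨_, by omega, rfl⟩
      symm := ⟨fun a b ⟨j, hj, hab⟩ => ⟨j, hj, hab.trans Sym2.eq_swap⟩⟩ }
  have hmem : ∀ i < p.length, p.getVert i ∈ p.support ∧ p.getVert i ≠ t := by
    intro i hi
    refine ⟨p.getVert_mem_support _, fun hit => ?_⟩
    have := hinj hi.le le_rfl (hit.trans p.getVert_length.symm)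
    omega
  refine ⟨N, ⟨⟨?_, ?_⟩, ?_, ?_⟩, ?_, ?_⟩
  · rintro _ ⟨i, hi, rfl⟩
    rw [Subgraph.deleteVerts_verts, Walk.verts_toSubgraph]
    exact hmem i hi
  · rintro a b hab
    have ha := N.edge_vert hab
    have hb := N.edge_vert hab.symm
    obtain ⟨i, hi, rfl⟩ := ha
    obtain ⟨i', hi', rfl⟩ := hb
    obtain ⟨j, hj, hab⟩ := hab
    rw [Subgraph.deleteVerts_adj, Walk.toSubgraph_adj_iff, Walk.verts_toSubgraph]
    exact ⟨(hmem i hi).1, (hmem i hi).2, (hmem i' hi').1, (hmem i' hi').2, 2 * j, hab, by omega⟩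
  · rintro _ ⟨i, hi, rfl⟩
    have huniq : ∀ b, N.Adj (p.getVert i) b →
        b = p.getVert (if i % 2 = 0 then i + 1 else i - 1) := by
      rintro b ⟨j, hj, hab⟩
      rcases Sym2.eq_iff.1 hab with ⟨h1, rfl⟩ | ⟨rfl, h1⟩
      · obtain rfl := hinj (by omega) hi.le h1
        simp
      · obtain rfl := hinj (by omega) hi.le h1
        rw [if_neg (by omega)]; simp
    refine ⟨_, ?_, huniq⟩
    split_ifs with hpar
    · exact ⟨i / 2, by omega, by rw [show 2 * (i / 2) = i by omega]⟩
    · exact ⟨i / 2, by omega, by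
        rw [show 2 * (i / 2) = i - 1 by omega, show i - 1 + 1 = i by omega]; exact Sym2.eq_swap⟩
  · rw [Subgraph.deleteVerts_verts, Walk.verts_toSubgraph]
    ext a
    constructor
    · rintro ⟨i, hi, rfl⟩
      exact hmem i hi
    · rintro ⟨ha, hat⟩
      obtain ⟨i, rfl, hi⟩ := Walk.mem_support_iff_exists_getVert.1 ha
      refine ⟨i, lt_of_le_of_ne hi ?_, rfl⟩
      rintro rfl
      exact hat p.getVert_length
  · rintro _ ⟨i, hi, rfl⟩
    have h1 := h (i / 2) (by omega)
    rcases Nat.mod_two_eq_zero_or_one i with hpar | hpar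
    · rw [show 2 * (i / 2) = i by omega] at h1
      exact M.edge_vert h1
    · rw [show 2 * (i / 2) + 1 = i by omega] at h1
      exact M.edge_vert h1.symm
  · rintro a b ⟨j, hj, hab⟩
    have h1 := h j hj
    rcases Sym2.eq_iff.1 hab with ⟨rfl, rfl⟩ | ⟨rfl, rfl⟩
    · exact h1
    · exact h1.symm

theorem Subgraph.containsPathMatching_reverse {M : H.Subgraph}
    (p : H.Walk s t) (a : W) : M.ContainsPathMatching p.reverse a ↔ M.ContainsPathMatching p a := by
  rw [Subgraph.ContainsPathMatching, Walk.toSubgraph_reverse]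
  rfl

end SimpleGraph

/-! ### Perfect matchings of the smashed dual refinement -/

namespace PlaneGraph

variable {V : Type*} {P : PlaneGraph V} {n : ℕ} {v v' : Fin (2 * n + 1) → V}
  {f f' : Fin n → P.BoundedFace}

/-- The dimension of the cell of the plane graph to which a vertex of the dual refinement belongs. -/
def dim : P.RefVertex → ℕ
  | .orig _ => 0
  | .edge _ => 1
  | .face _ => 2

theorem dim_adj {a b : P.RefVertex} (h : P.dualRefinement.Adj a b) : dim a = 1 ↔ dim b ≠ 1 := by
  cases a <;> cases b <;> first | exact h.elim | simp [dim]

theorem exists_edge_of_dim {a : P.RefVertex} (h : dim a = 1) : ∃ e, a = .edge e := by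
  cases a <;> simp_all [dim]

/-- An edge has only two ends and lies on at most two faces. -/
theorem eq_or_eq_of_adj {e : P.graph.edgeSet} {a b c : P.RefVertex}
    (ha : P.dualRefinement.Adj (.edge e) a) (hb : P.dualRefinement.Adj (.edge e) b)
    (hc : P.dualRefinement.Adj (.edge e) c) (hac : a ≠ c) (hab : dim a = dim b)
    (hbc : dim b = dim c) : b = a ∨ b = c := by
  rcases a with x | _ | g <;> rcases b with y | _ | g' <;> rcases c with z | _ | g'' <;>
    first
      | exact False.elim ha | exact False.elim hb | exact False.elim hc
      | (cases hab; done) | (cases hbc; done) | skip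
  · change x ∈ e.1 at ha
    change y ∈ e.1 at hb
    change z ∈ e.1 at hc
    have hxz : x ≠ z := fun h => hac (h ▸ rfl)
    have he := (Sym2.mem_and_mem_iff hxz).1 ⟨ha, hc⟩
    rw [he, Sym2.mem_iff] at hb
    exact hb.imp (congrArg _) (congrArg _)
  · change P.EdgeOn e g.1 at ha
    change P.EdgeOn e g'.1 at hb
    change P.EdgeOn e g''.1 at hc
    have hne : g.1 ≠ g''.1 := fun h => hac (Subtype.ext h ▸ rfl)
    obtain ⟨d, hd, rfl⟩ := P.exists_dart_iff_edgeOn.2 ha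
    rw [P.edgeOn_dartEdge, hd] at hb hc
    have hc' := hc.resolve_left hne
    rw [hc'] at hb
    exact hb.imp (fun h => congrArg _ (Subtype.ext h.symm)) (fun h => congrArg _ (Subtype.ext h.symm))

/-- The smashed dual refinement without the terminals `v₁, f₂, v₃, …, v₂ₙ₊₁`. -/
abbrev remainder (P : PlaneGraph V) (v v' : Fin (2 * n + 1) → V) (f : Fin n → P.BoundedFace) :
    P.dualRefinement.Subgraph :=
  (P.smashedRefinement v v').deleteVerts (Set.range (P.terminal v f))

theorem smashedRefinement_comm : P.smashedRefinement v v' = P.smashedRefinement v' v := by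
  rw [smashedRefinement, union_comm]; rfl

theorem dim_terminal (i : Fin (2 * n + 1)) : dim (P.terminal v f i) ≠ 1 := by
  unfold terminal
  split_ifs <;> simp [dim]

theorem mem_remainder {a : P.RefVertex} : a ∈ (P.remainder v v' f).verts ↔
    (∀ k : Fin n, a ∉ P.smashedVerts (v (evenPos k)) ∧ a ∉ P.smashedVerts (v' (evenPos k))) ∧
      ∀ i, P.terminal v f i ≠ a := by
  simp only [remainder, smashedRefinement, smashed, SimpleGraph.Subgraph.deleteVerts_verts,
    SimpleGraph.Subgraph.verts_top, mem_sdiff, mem_univ, true_and, mem_iUnion, mem_union, mem_range,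
    not_exists]
  refine and_congr_left fun _ => ⟨fun h k => ⟨fun hk => ?_, fun hk => ?_⟩, ?_⟩
  · exact h _ (Or.inl ⟨k, rfl⟩) hk
  · exact h _ (Or.inr ⟨k, rfl⟩) hk
  · rintro h x (⟨k, rfl⟩ | ⟨k, rfl⟩)
    · exact (h k).1
    · exact (h k).2

theorem remainder_adj {a b : P.RefVertex} : (P.remainder v v' f).Adj a b ↔
    a ∈ (P.remainder v v' f).verts ∧ b ∈ (P.remainder v v' f).verts ∧
      P.dualRefinement.Adj a b := by
  simp only [remainder, smashedRefinement, smashed, SimpleGraph.Subgraph.deleteVerts_verts,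
    SimpleGraph.Subgraph.verts_top, mem_sdiff, mem_univ, true_and,
    SimpleGraph.Subgraph.deleteVerts_adj, SimpleGraph.Subgraph.top_adj]
  tauto

theorem orig_mem_remainder {x : V} :
    .orig x ∈ (P.remainder v v' f).verts ↔ x ∈ freeVert v v' := by
  rw [mem_remainder]
  simp only [smashedVerts, mem_ofPred_eq, RefVertex.orig.injEq, reduceCtorEq, false_and,
    exists_false, or_false]
  constructor
  · rintro ⟨h1, h2⟩
    refine ⟨fun i hi => ?_, fun k hk => (h1 k).2 hk.symm⟩
    rcases Nat.mod_two_eq_zero_or_one i.1 with h | h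
    · exact h2 i (by rw [terminal, dif_pos h, hi])
    · refine (h1 ⟨i.1 / 2, by omega⟩).1 (hi.symm.trans (congrArg v (Fin.ext ?_)))
      simp only [evenPos]; omega
  · rintro ⟨h1, h2⟩
    refine ⟨fun k => ⟨fun h => h1 _ h.symm, fun h => h2 k h.symm⟩, fun i hi => ?_⟩
    unfold terminal at hi
    split_ifs at hi
    exact h1 i (by simpa using hi)

theorem face_mem_remainder {g : P.BoundedFace} :
    .face g ∈ (P.remainder v v' f).verts ↔ g.1 ∈ freeFace f := by
  rw [mem_remainder]
  simp only [smashedVerts, mem_ofPred_eq, reduceCtorEq, false_and,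
    exists_false, or_false, not_false_eq_true, and_self]
  constructor
  · refine fun ⟨_, h⟩ => ⟨g.2, fun k hk => h (evenPos k) ?_⟩
    have h1 : ¬ ((evenPos k).1 % 2 = 0) := by simp only [evenPos]; omega
    rw [terminal, dif_neg h1]
    congr 1
    rw [← Subtype.ext hk]
    congr 1
    ext
    simp only [evenPos]; omega
  · rintro ⟨-, h⟩
    refine ⟨fun _ => trivial, fun i hi => ?_⟩
    unfold terminal at hi
    split_ifs at hi
    exact h _ (congrArg Subtype.val (RefVertex.face.inj hi))

/-- Smashing in removes all edges at the vertices with even index: since these vertices have degree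
two, both their edges are on the infinite face. -/
theorem IsTrackPair.edge_mem_remainder (H : P.IsTrackPair v v' f f') {e : P.graph.edgeSet} :
    .edge e ∈ (P.remainder v v' f).verts ↔ e ∈ P.freeEdge v v' := by
  rw [mem_remainder]
  simp only [smashedVerts, mem_ofPred_eq, reduceCtorEq, false_or, RefVertex.edge.injEq]
  constructor
  · rintro ⟨h, -⟩ k
    refine ⟨fun hk => (h k).1 ⟨e, rfl, hk, ?_⟩, fun hk => (h k).2 ⟨e, rfl, hk, ?_⟩⟩
    · rcases H.left.eq_pathEdge hk with rfl | rfl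
      · exact (H.left.edgeOn_pathEdge (Or.inl rfl)).2 (Or.inl rfl)
      · exact (H.left.edgeOn_pathEdge (Or.inr rfl)).2 (Or.inl rfl)
    · rcases H.right.eq_pathEdge hk with rfl | rfl
      · exact (H.right.edgeOn_pathEdge (Or.inl rfl)).2 (Or.inl rfl)
      · exact (H.right.edgeOn_pathEdge (Or.inr rfl)).2 (Or.inl rfl)
  · intro h
    refine ⟨fun k => ⟨?_, ?_⟩, fun i hi => dim_terminal i (by rw [hi]; rfl)⟩
    · rintro ⟨e', rfl, hk, -⟩
      exact (h k).1 hk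
    · rintro ⟨e', rfl, hk, -⟩
      exact (h k).2 hk

/-- The edges of the plane graph that are matched to one of their endpoints. -/
def primalEdges (M : P.dualRefinement.Subgraph) : Set P.graph.edgeSet :=
  {e | ∃ x, M.Adj (.orig x) (.edge e)}

/-- A perfect matching is given by an orientation. -/
theorem exists_isOrientation (H : P.IsTrackPair v v' f f') {M : P.dualRefinement.Subgraph}
    (hM : M.IsPerfectMatchingOf (P.remainder v v' f)) :
    ∃ mX mY, P.IsOrientation v v' f mX mY ∧
      (∀ x e, M.Adj (.orig x) (.edge e) ↔ x ∈ freeVert v v' ∧ mX x = e) ∧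
      ∀ g e, M.Adj (.face g) (.edge e) ↔ g.1 ∈ freeFace f ∧ mY g.1 = e := by
  obtain ⟨hle, hm, hverts⟩ := hM
  have hX : ∀ x, ∃ e, x ∈ freeVert v v' → M.Adj (.orig x) (.edge e) := by
    intro x
    by_cases hx : x ∈ freeVert v v'
    · obtain ⟨a, ha, -⟩ := hm (hverts ▸ orig_mem_remainder.2 hx)
      obtain ⟨e, rfl⟩ := exists_edge_of_dim (by_contra fun h1 =>
        absurd ((dim_adj (M.adj_sub ha)).2 h1) (by simp [dim]))
      exact ⟨e, fun _ => ha⟩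
    · exact ⟨P.dartEdge P.outerDart, fun h => absurd h hx⟩
  have hY : ∀ g, ∃ e, ∀ hg : g ∈ freeFace f, M.Adj (.face ⟨g, hg.1⟩) (.edge e) := by
    intro g
    by_cases hg : g ∈ freeFace f
    · have hg' : (RefVertex.face ⟨g, hg.1⟩ : P.RefVertex) ∈ M.verts :=
        hverts ▸ face_mem_remainder.2 hg
      obtain ⟨a, ha, -⟩ := hm hg'
      obtain ⟨e, rfl⟩ := exists_edge_of_dim (by_contra fun h1 =>
        absurd ((dim_adj (M.adj_sub ha)).2 h1) (by simp [dim]))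
      exact ⟨e, fun _ => ha⟩
    · exact ⟨P.dartEdge P.outerDart, fun h => absurd h hg⟩
  choose mX hmX using hX
  choose mY hmY using hY
  have hedge : ∀ {a e}, M.Adj a (.edge e) → e ∈ P.freeEdge v v' := fun ha =>
    H.edge_mem_remainder.1 (hverts ▸ M.edge_vert ha.symm)
  have hXiff : ∀ x e, M.Adj (.orig x) (.edge e) ↔ x ∈ freeVert v v' ∧ mX x = e := by
    refine fun x e => ⟨fun h => ?_, fun ⟨h1, h2⟩ => h2 ▸ hmX x h1⟩
    have hx : x ∈ freeVert v v' := orig_mem_remainder.1 (hverts ▸ M.edge_vert h)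
    exact ⟨hx, RefVertex.edge.inj (hm.eq_of_adj_left (hmX x hx) h)⟩
  have hYiff : ∀ g e, M.Adj (.face g) (.edge e) ↔ g.1 ∈ freeFace f ∧ mY g.1 = e := by
    refine fun g e => ⟨fun h => ?_, fun ⟨h1, h2⟩ => h2 ▸ hmY g.1 h1⟩
    have hg : g.1 ∈ freeFace f := face_mem_remainder.1 (hverts ▸ M.edge_vert h)
    exact ⟨hg, RefVertex.edge.inj (hm.eq_of_adj_left (hmY g.1 hg) h)⟩
  refine ⟨mX, mY, ⟨fun x hx => M.adj_sub (hmX x hx), fun x hx => hedge (hmX x hx),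
    fun g hg => M.adj_sub (hmY g hg), fun g hg => hedge (hmY g hg), ?_, ?_, ?_, ?_⟩, hXiff, hYiff⟩
  · intro x hx y hy hxy
    exact RefVertex.orig.inj (hm.eq_of_adj_right (hmX x hx) (hxy ▸ hmX y hy))
  · intro g hg g' hg' hgg
    exact congrArg Subtype.val
      (RefVertex.face.inj (hm.eq_of_adj_right (hmY g hg) (hgg ▸ hmY g' hg')))
  · intro x hx g hg hxg
    have := hm.eq_of_adj_right (hmX x hx) (hxg ▸ hmY g hg)
    cases this
  · intro e he
    obtain ⟨a, ha, -⟩ := hm (hverts ▸ H.edge_mem_remainder.2 he)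
    rcases a with x | e' | g
    · exact Or.inl ⟨x, (hXiff x e).1 ha.symm⟩
    · exact False.elim (M.adj_sub ha)
    · exact Or.inr ⟨g.1, (hYiff g e).1 ha.symm⟩

theorem primalEdges_eq {M : P.dualRefinement.Subgraph} {mX : V → P.graph.edgeSet}
    (h : ∀ x e, M.Adj (.orig x) (.edge e) ↔ x ∈ freeVert v v' ∧ mX x = e) :
    primalEdges M = mX '' freeVert v v' := by
  ext e
  exact exists_congr fun x => h x e

/-- The adjacency relation of the matching given by an orientation. -/
def orientationAdj (v v' : Fin (2 * n + 1) → V) (f : Fin n → P.BoundedFace)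
    (mX : V → P.graph.edgeSet) (mY : P.Face → P.graph.edgeSet) : P.RefVertex → P.RefVertex → Prop
  | .orig x, .edge e => x ∈ freeVert v v' ∧ mX x = e
  | .edge e, .orig x => x ∈ freeVert v v' ∧ mX x = e
  | .face g, .edge e => g.1 ∈ freeFace f ∧ mY g.1 = e
  | .edge e, .face g => g.1 ∈ freeFace f ∧ mY g.1 = e
  | _, _ => False

theorem IsOrientation.exists_isPerfectMatchingOf (H : P.IsTrackPair v v' f f')
    {mX : V → P.graph.edgeSet} {mY : P.Face → P.graph.edgeSet}
    (h : P.IsOrientation v v' f mX mY) :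
    ∃ M : P.dualRefinement.Subgraph, M.IsPerfectMatchingOf (P.remainder v v' f) ∧
      ∀ x e, M.Adj (.orig x) (.edge e) ↔ x ∈ freeVert v v' ∧ mX x = e := by
  let M : P.dualRefinement.Subgraph :=
    { verts := (P.remainder v v' f).verts
      Adj := orientationAdj v v' f mX mY
      adj_sub := by
        rintro (x | e | g) (y | e' | g') hab
        all_goals first
          | exact False.elim hab
          | (obtain ⟨h1, rfl⟩ := hab; first | exact h.vert_mem _ h1 | exact h.face_mem _ h1)
      edge_vert := by
        rintro (x | e | g) (y | e' | g') hab
        all_goals first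
          | exact False.elim hab
          | exact orig_mem_remainder.2 hab.1
          | exact face_mem_remainder.2 hab.1
          | (obtain ⟨h1, rfl⟩ := hab
             exact H.edge_mem_remainder.2 (by first | exact h.vert_free h1 | exact h.face_free h1))
      symm := ⟨by rintro (x | e | g) (y | e' | g') hab <;> exact hab⟩ }
  refine ⟨M, ⟨⟨le_rfl, fun a b hab => remainder_adj.2
    ⟨M.edge_vert hab, M.edge_vert hab.symm, M.adj_sub hab⟩⟩, ?_, rfl⟩, fun x e => Iff.rfl⟩
  rintro (x | e | g) ha
  · refine ⟨.edge (mX x), ⟨orig_mem_remainder.1 ha, rfl⟩, ?_⟩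
    rintro (y | e | g) hb
    · exact False.elim hb
    · exact congrArg _ hb.2.symm
    · exact False.elim hb
  · rcases h.cover e (H.edge_mem_remainder.1 ha) with ⟨x, hx, rfl⟩ | ⟨g, hg, rfl⟩
    · refine ⟨.orig x, ⟨hx, rfl⟩, ?_⟩
      rintro (y | e | g) hb
      · exact congrArg _ (h.injOn_vert hb.1 hx hb.2)
      · exact False.elim hb
      · exact absurd hb.2.symm (h.disjoint x hx g.1 hb.1)
    · refine ⟨.face ⟨g, hg.1⟩, ⟨hg, rfl⟩, ?_⟩
      rintro (y | e | g') hb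
      · exact absurd hb.2 (h.disjoint y hb.1 g hg)
      · exact False.elim hb
      · exact congrArg _ (Subtype.ext (h.injOn_face hb.1 hg hb.2))
  · refine ⟨.edge (mY g.1), ⟨face_mem_remainder.1 ha, rfl⟩, ?_⟩
    rintro (y | e | g) hb
    · exact False.elim hb
    · exact congrArg _ hb.2.symm
    · exact False.elim hb

theorem exists_matching_primalEdges_eq [Finite V] (H : P.IsTrackPair v v' f f')
    {M : P.dualRefinement.Subgraph} (hM : M.IsPerfectMatchingOf (P.remainder v v' f)) :
    ∃ M' : P.dualRefinement.Subgraph, M'.IsPerfectMatchingOf (P.remainder v' v f') ∧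
      primalEdges M' = primalEdges M := by
  obtain ⟨mX, mY, ho, hX, -⟩ := exists_isOrientation H hM
  obtain ⟨mX', mY', ho', himg⟩ := H.exists_orientation ho
  obtain ⟨M', hM', hX'⟩ := ho'.exists_isPerfectMatchingOf H.symm
  exact ⟨M', hM', by rw [primalEdges_eq hX', primalEdges_eq hX, himg]⟩

theorem eq_of_primalEdges_eq [Finite V] (H : P.IsTrackPair v v' f f')
    {M M₂ : P.dualRefinement.Subgraph} (hM : M.IsPerfectMatchingOf (P.remainder v v' f))
    (hM₂ : M₂.IsPerfectMatchingOf (P.remainder v v' f)) (heq : primalEdges M = primalEdges M₂) :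
    M = M₂ := by
  obtain ⟨mX, mY, ho, hX, hY⟩ := exists_isOrientation H hM
  obtain ⟨mX₂, mY₂, ho₂, hX₂, hY₂⟩ := exists_isOrientation H hM₂
  rw [primalEdges_eq hX, primalEdges_eq hX₂] at heq
  obtain ⟨e1, e2⟩ := H.orientation_unique ho ho₂ heq
  have h1 : ∀ x e, M.Adj (.orig x) (.edge e) ↔ M₂.Adj (.orig x) (.edge e) := fun x e => by
    rw [hX, hX₂]
    exact and_congr_right fun hx => by rw [e1 hx]
  have h2 : ∀ g e, M.Adj (.face g) (.edge e) ↔ M₂.Adj (.face g) (.edge e) := fun g e => by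
    rw [hY, hY₂]
    exact and_congr_right fun hg => by rw [e2 hg]
  refine SimpleGraph.Subgraph.ext (hM.2.2.trans hM₂.2.2.symm) ?_
  funext a b
  refine propext ?_
  rcases a with x | e | g <;> rcases b with y | e' | g'
  all_goals first
    | exact h1 _ _
    | exact h2 _ _
    | (rw [M.adj_comm, M₂.adj_comm]; first | exact h1 _ _ | exact h2 _ _)
    | exact ⟨fun h => False.elim (M.adj_sub h), fun h => False.elim (M₂.adj_sub h)⟩

open Classical in
/-- The weight that an edge-vertex contributes to a matching: the weight of the edge if it is in `F`,
and otherwise the weight of the dual edge, or `1` if there is none. -/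
noncomputable def selectedWeight {R : Type*} [CommMonoid R] (w : P.graph.edgeSet → R)
    (w' : P.DualEdge → R) (F : Set P.graph.edgeSet) (e : P.graph.edgeSet) : R :=
  if e ∈ F then w e else if h : P.IsDualEdge e then w' ⟨e, h⟩ else 1

/-- The weight of a matching depends only on its set of primal edges. -/
theorem weight_eq (H : P.IsTrackPair v v' f f') {R : Type*} [CommMonoid R]
    (w : P.graph.edgeSet → R) (w' : P.DualEdge → R) {M : P.dualRefinement.Subgraph}
    (hM : M.IsPerfectMatchingOf (P.remainder v v' f)) :
    P.weight w w' M = ∏ᶠ e ∈ P.freeEdge v v', selectedWeight w w' (primalEdges M) e := by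
  obtain ⟨-, hm, hverts⟩ := hM
  have hpart : ∀ e, ∃ a, e ∈ P.freeEdge v v' → M.Adj (.edge e) a := by
    intro e
    by_cases he : e ∈ P.freeEdge v v'
    · obtain ⟨a, ha, -⟩ := hm (hverts ▸ H.edge_mem_remainder.2 he)
      exact ⟨a, fun _ => ha⟩
    · exact ⟨.edge e, fun h => absurd h he⟩
  choose b hb using hpart
  symm
  refine finprod_mem_eq_of_bijOn (fun e => s(RefVertex.edge e, b e)) ⟨?_, ?_, ?_⟩ ?_
  · exact fun e he => hb e he
  · intro e he e' he' hee
    rcases Sym2.eq_iff.1 hee with ⟨h1, -⟩ | ⟨-, h1⟩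
    · exact RefVertex.edge.inj h1
    · have h2 := M.adj_sub (hb e he)
      rw [h1] at h2
      exact False.elim h2
  · intro z hz
    induction z with
    | _ a c =>
      have hz : M.Adj a c := hz
      have key : ∀ {e c}, M.Adj (.edge e) c → e ∈ P.freeEdge v v' ∧ b e = c := fun {e c} h => by
        have he : e ∈ P.freeEdge v v' := H.edge_mem_remainder.1 (hverts ▸ M.edge_vert h)
        exact ⟨he, hm.eq_of_adj_left (hb e he) h⟩
      by_cases ha : dim a = 1
      · obtain ⟨e, rfl⟩ := exists_edge_of_dim ha
        obtain ⟨h1, rfl⟩ := key hz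
        exact ⟨e, h1, rfl⟩
      · obtain ⟨e, rfl⟩ := exists_edge_of_dim
          (not_not.1 fun h1 => ha ((dim_adj (M.adj_sub hz)).2 h1))
        obtain ⟨h1, rfl⟩ := key hz.symm
        exact ⟨e, h1, Sym2.eq_swap⟩
  · intro e he
    have hadj := hb e he
    change selectedWeight w w' (primalEdges M) e = P.pairWeight w w' (.edge e) (b e)
    generalize b e = c at hadj
    rcases c with x | e' | g
    · rw [selectedWeight, if_pos ⟨x, hadj.symm⟩]
      rfl
    · exact False.elim (M.adj_sub hadj)
    · rw [selectedWeight, if_neg]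
      · rfl
      · rintro ⟨x, hx⟩
        cases hm.eq_of_adj_right hx hadj.symm

theorem dim_eq_of_primalEdges_eq (H : P.IsTrackPair v v' f f') {M M' : P.dualRefinement.Subgraph}
    (hM : M.IsPerfectMatchingOf (P.remainder v v' f))
    (hM' : M'.IsPerfectMatchingOf (P.remainder v' v f')) (hF : primalEdges M' = primalEdges M)
    {e : P.graph.edgeSet} {a : P.RefVertex} (ha : M.Adj (.edge e) a) :
    ∃ b, M'.Adj (.edge e) b ∧ dim b = dim a := by
  have he : RefVertex.edge e ∈ M'.verts := by
    rw [hM'.2.2, H.symm.edge_mem_remainder, freeEdge_comm, ← H.edge_mem_remainder, ← hM.2.2]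
    exact M.edge_vert ha
  obtain ⟨b, hb, -⟩ := hM'.2.1 he
  refine ⟨b, hb, ?_⟩
  rcases a with x | e' | g
  · have h1 : e ∈ primalEdges M' := hF ▸ ⟨x, ha.symm⟩
    obtain ⟨y, hy⟩ := h1
    rw [hM'.2.1.eq_of_adj_left hb hy.symm]
    rfl
  · exact False.elim (M.adj_sub ha)
  · rcases b with y | e' | g'
    · have h1 : e ∈ primalEdges M := hF ▸ ⟨y, hb.symm⟩
      obtain ⟨z, hz⟩ := h1
      cases hM.2.1.eq_of_adj_left ha hz.symm
    · exact False.elim (M'.adj_sub hb)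
    · rfl

theorem dim_getVert {a b : P.RefVertex} (p : P.dualRefinement.Walk a b) (ha : dim a ≠ 1) (i : ℕ)
    (hi : i ≤ p.length) : dim (p.getVert i) = 1 ↔ i % 2 = 1 := by
  induction i with
  | zero => simp [ha]
  | succ i ih =>
    have h1 := ih (by omega)
    have h2 := dim_adj (p.adj_getVert_succ (i := i) (by omega))
    rw [h1] at h2
    have h3 : (i + 1) % 2 = 1 ↔ ¬ (i % 2 = 1) := by omega
    rw [h3, h2, not_not]

/-- If `M` contains the matching of a path without its starting point, then a matching with the same
primal edges that avoids the end of the path contains the matching of the path without its end. All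
cells on the path that are not edges have the same dimension `c`. -/
theorem containsPathMatching_of_primalEdges_eq (H : P.IsTrackPair v v' f f')
    {M M' : P.dualRefinement.Subgraph}
    (hM : M.IsPerfectMatchingOf (P.remainder v v' f))
    (hM' : M'.IsPerfectMatchingOf (P.remainder v' v f')) (hF : primalEdges M' = primalEdges M)
    {i : Fin (2 * n + 1)} (p : P.dualRefinement.Walk (P.terminal v f i) (P.terminal v' f' i))
    (hp : p.IsPath) {c : ℕ} (hc : ∀ a ∈ p.support, dim a = 1 ∨ dim a = c)
    (h : M.ContainsPathMatching p (P.terminal v f i)) :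
    M'.ContainsPathMatching p (P.terminal v' f' i) := by
  have hinj : ∀ {a b}, a ≤ p.length → b ≤ p.length → p.getVert a = p.getVert b → a = b :=
    fun ha hb hab => hp.getVert_injOn ha hb hab
  have hpar := fun j hj => dim_getVert p (dim_terminal i) j hj
  have heven : p.length % 2 ≠ 1 := by
    rw [Ne, ← hpar _ le_rfl, p.getVert_length]
    exact dim_terminal i
  obtain ⟨L, hL⟩ : ∃ L, p.length = 2 * L := ⟨p.length / 2, by omega⟩
  have hdim : ∀ j ≤ L, dim (p.getVert (2 * j)) = c := fun j hj =>
    (hc _ (p.getVert_mem_support _)).resolve_left fun h1 => by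
      have := (hpar _ (by omega)).1 h1
      omega
  refine SimpleGraph.Subgraph.containsPathMatching_of_adj hp hL fun j hj => ?_
  -- downward induction on `j`, from the end of the path
  induction hk : L - 1 - j generalizing j with
  | zero | succ k ih => ?_
  all_goals
    obtain ⟨e, he⟩ := exists_edge_of_dim ((hpar (2 * j + 1) (by omega)).2 (by omega))
    have hadj := h.adj hp j (by omega)
    have h1 := (p.adj_getVert_succ (i := 2 * j) (by omega)).symm
    rw [he] at hadj h1
    obtain ⟨b, hb, hbd⟩ := dim_eq_of_primalEdges_eq H hM hM' hF hadj
    have hd0 := hdim j hj.le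
    have hd1 : dim (p.getVert (2 * j + 2)) = c := hdim (j + 1) hj
    have hne : p.getVert (2 * j) ≠ p.getVert (2 * j + 2) := fun h2 => by
      have := hinj (by omega) (by omega) h2
      omega
    have hor := eq_or_eq_of_adj h1 (M'.adj_sub hb) (M.adj_sub hadj) hne
      (by rw [hd0, hbd, hd1]) hbd
    rw [he]
    rcases hor with rfl | rfl
    · exact hb.symm
    exfalso
  · have h2 := M'.edge_vert hb.symm
    rw [show 2 * j + 2 = p.length by omega, p.getVert_length, hM'.2.2, mem_remainder] at h2
    exact h2.2 i rfl
  · have h2 := ih (j + 1) (by omega) (by omega)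
    have h3 := hM'.2.1.eq_of_adj_left h2 hb.symm
    rw [← he] at h3
    have := hinj (by omega) (by omega) h3
    omega

theorem IsPathFamily.exists_dim
    {p : ∀ i, P.dualRefinement.Walk (P.terminal v f i) (P.terminal v' f' i)}
    (hp : P.IsPathFamily v v' f f' p) (i : Fin (2 * n + 1)) :
    ∃ c, ∀ a ∈ (p i).support, dim a = 1 ∨ dim a = c := by
  rcases Nat.mod_two_eq_zero_or_one i.1 with h | h
  · refine ⟨0, ?_⟩
    rintro (x | e | g) ha
    · exact Or.inr rfl
    · exact Or.inl rfl
    · exact absurd ha (hp.inGraph i h g)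
  · refine ⟨2, ?_⟩
    rintro (x | e | g) ha
    · exact absurd ha (hp.inDual i h x)
    · exact Or.inl rfl
    · exact Or.inr rfl

end PlaneGraph

/-! ### The bijection -/

/-- An injective invariant with the same values on two sets gives a bijection preserving it. -/
theorem exists_equiv_of_invariant {α β : Type*} {p q : α → Prop} (F : α → β)
    (hpq : ∀ a, p a → ∃ b, q b ∧ F b = F a) (hqp : ∀ b, q b → ∃ a, p a ∧ F a = F b)
    (hp : ∀ a a', p a → p a' → F a = F a' → a = a')
    (hq : ∀ b b', q b → q b' → F b = F b' → b = b') :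
    ∃ φ : {a // p a} ≃ {b // q b}, ∀ a, F (φ a).1 = F a.1 := by
  choose φ hφq hφ using hpq
  choose ψ hψp hψ using hqp
  exact ⟨⟨fun a => ⟨φ a.1 a.2, hφq _ _⟩, fun b => ⟨ψ b.1 b.2, hψp _ _⟩,
    fun a => Subtype.ext (hp _ _ (hψp _ _) a.2 ((hψ _ _).trans (hφ _ _))),
    fun b => Subtype.ext (hq _ _ (hφq _ _) b.2 ((hφ _ _).trans (hψ _ _)))⟩, fun a => hφ _ _⟩

theorem theorem5p1 {V : Type*} [Finite V] (P : PlaneGraph V)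
    (hleaf : ∀ x : V, (P.graph.neighborSet x).ncard = 1 → P.VertexOn x P.outer)
    {R : Type*} [CommMonoid R] (w : P.graph.edgeSet → R) (w' : P.DualEdge → R)
    (n : ℕ) (v v' : Fin (2 * n + 1) → V) (f f' : Fin n → P.BoundedFace)
    (h : P.IsAdmissible v v' f f') :
    (∃ φ :
        {M : P.dualRefinement.Subgraph // M.IsPerfectMatchingOf
          ((P.smashedRefinement v v').deleteVerts (Set.range (P.terminal v f)))} ≃
        {M : P.dualRefinement.Subgraph // M.IsPerfectMatchingOf
          ((P.smashedRefinement v v').deleteVerts (Set.range (P.terminal v' f')))},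
      ∀ M, P.weight w w' (φ M).1 = P.weight w w' M.1) ∧
    (∀ p : (∀ i : Fin (2 * n + 1),
          P.dualRefinement.Walk (P.terminal v f i) (P.terminal v' f' i)),
      P.IsPathFamily v v' f f' p →
      ∀ I : Set (Fin (2 * n + 1)),
      ∃ φ :
        {M : P.dualRefinement.Subgraph // M.IsPerfectMatchingOf
            ((P.smashedRefinement v v').deleteVerts (Set.range (P.terminal v f))) ∧
          ∀ i ∈ I, M.ContainsPathMatching (p i) (P.terminal v f i)} ≃
        {M : P.dualRefinement.Subgraph // M.IsPerfectMatchingOf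
            ((P.smashedRefinement v v').deleteVerts (Set.range (P.terminal v' f'))) ∧
          ∀ i ∈ I, M.ContainsPathMatching (p i) (P.terminal v' f' i)},
      ∀ M, P.weight w w' (φ M).1 = P.weight w w' M.1) := by

  have H := h.isTrackPair
  have hcomm : P.remainder v' v f' =
      (P.smashedRefinement v v').deleteVerts (Set.range (P.terminal v' f')) := by
    rw [PlaneGraph.remainder, PlaneGraph.smashedRefinement_comm]
  have hweight : ∀ M M' : P.dualRefinement.Subgraph,
      M.IsPerfectMatchingOf (P.remainder v v' f) → M'.IsPerfectMatchingOf (P.remainder v' v f') →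
      PlaneGraph.primalEdges M' = PlaneGraph.primalEdges M →
      P.weight w w' M' = P.weight w w' M := by
    intro M M' hM hM' hF
    rw [PlaneGraph.weight_eq H w w' hM, PlaneGraph.weight_eq H.symm w w' hM', hF,
      PlaneGraph.freeEdge_comm]
  rw [← hcomm]
  constructor
  · obtain ⟨φ, hφ⟩ := exists_equiv_of_invariant PlaneGraph.primalEdges
      (fun M hM => PlaneGraph.exists_matching_primalEdges_eq H (M := M) hM)
      (fun M hM => PlaneGraph.exists_matching_primalEdges_eq H.symm (M := M) hM)
      (fun M M₂ => PlaneGraph.eq_of_primalEdges_eq H)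
      (fun M M₂ => PlaneGraph.eq_of_primalEdges_eq H.symm)
    exact ⟨φ, fun M => hweight _ _ M.2 (φ M).2 (hφ M)⟩
  · intro p hp I
    obtain ⟨φ, hφ⟩ := exists_equiv_of_invariant PlaneGraph.primalEdges
      (p := fun M => M.IsPerfectMatchingOf (P.remainder v v' f) ∧
        ∀ i ∈ I, M.ContainsPathMatching (p i) (P.terminal v f i))
      (q := fun M => M.IsPerfectMatchingOf (P.remainder v' v f') ∧
        ∀ i ∈ I, M.ContainsPathMatching (p i) (P.terminal v' f' i))
      (fun M hM => by
        obtain ⟨M', hM', hF⟩ := PlaneGraph.exists_matching_primalEdges_eq H hM.1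
        refine ⟨M', ⟨hM', fun i hi => ?_⟩, hF⟩
        obtain ⟨c, hc⟩ := hp.exists_dim i
        exact PlaneGraph.containsPathMatching_of_primalEdges_eq H hM.1 hM' hF (p i)
          (hp.isPath i) hc (hM.2 i hi))
      (fun M' hM' => by
        obtain ⟨M, hM, hF⟩ := PlaneGraph.exists_matching_primalEdges_eq H.symm hM'.1
        refine ⟨M, ⟨hM, fun i hi => ?_⟩, hF⟩
        obtain ⟨c, hc⟩ := hp.exists_dim i
        rw [← SimpleGraph.Subgraph.containsPathMatching_reverse]
        refine PlaneGraph.containsPathMatching_of_primalEdges_eq H.symm hM'.1 hM hF (p i).reverse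
          (hp.isPath i).reverse (c := c) (fun a ha => hc a ?_) ?_
        · rwa [SimpleGraph.Walk.support_reverse, List.mem_reverse] at ha
        · rw [SimpleGraph.Subgraph.containsPathMatching_reverse]
          exact hM'.2 i hi)
      (fun M M₂ hM hM₂ => PlaneGraph.eq_of_primalEdges_eq H hM.1 hM₂.1)
      (fun M M₂ hM hM₂ => PlaneGraph.eq_of_primalEdges_eq H.symm hM.1 hM₂.1)
    exact ⟨φ, fun M => hweight _ _ M.2.1 (φ M).2.1 (hφ M)⟩
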